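/- Let $m,n\ge 1$ and, for $i=1,\dots,m$, let $0<\beta_i\le1$, $\gamma_i\in\mathbb R$, $1\le p,p_i<\infty$ with $\frac1{p_1}+\dots+\frac1{p_m}=\frac1p$, and $\zeta>0$. **Exponents and spaces.** For a measurable $p(\cdot):\mathbb R^n\to[1,\infty]$ and measurable $f:\mathbb R^n\to\mathbb C$ put $F_p(f)=\int_{\{p<\infty\}}|f(x)|^{p(x)}dx+\|f\|_{L^\infty(\{p=\infty\})}$ and $\|f\|_{L^{p(\cdot)}}=\inf\{\eta>0:F_p(f/\eta)\le1\}$ (the same formulas are used for any measurable $p(\cdot):\mathbb R^n\to(0,\infty]$); for a weight $\omega$ put $\|f\|_{L^{p(\cdot)}_\omega}=\|f\omega\|_{L^{p(\cdot)}}$. Write $p_-,p_+$ for the essential infimum and supremum. $\mathcal P_b$ is the set of measurable $q(\cdot)$ with $1<q_-\le q(x)\le q_+<\infty$ for all $x$; $\mathcal P_\infty$ is the set of measurable $r(\cdot):\mathbb R^n\to[1,\infty]$ for which $r_\infty=\lim_{|x|\to\infty}r(x)$ exists in $[1,\infty]$. A function $\alpha:\mathbb R^n\to\mathbb R$ is in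 $\mathbf C_0^{\log}$ if $|\alpha(x)-\alpha(0)|\le C/\log(e+1/|x|)$ for all $x \neq 0$, and in $\mathbf C^{\log}_\infty$, with value $\alpha_\infty$ at infinity, if $|\alpha(x)-\alpha_\infty|\le C/\log(e+|x|)$ for all $x$, for some constant $C$. With $C_k=\{2^{k-1}<|x|\le2^k\}$ and $\chi_k=\chi_{C_k}$, the weighted variable exponent Herz space $\dot K^{\alpha(\cdot),p}_{q(\cdot),\omega}$ consists of all $f\in L^{q(\cdot)}_{\rm loc}(\mathbb R^n\setminus\{0\})$ with $$\|f\|_{\dot K^{\alpha(\cdot),p}_{q(\cdot),\omega}}=\Big(\sum_{k\in\mathbb Z}\|2^{k\alpha(\cdot)}f\chi_k\|_{L^{q(\cdot)}_\omega}^p\Big)^{1/p}<\infty .$$ For a matrix, $\|A\|=(\sum_{j,k}|a_{jk}|^2)^{1/2}$. **Data.** Let $q_i\in\mathcal P_b$, $r_i\in\mathcal P_\infty$, $\alpha_i\in L^\infty\cap\mathbf C_0^{\log}\cap\mathbf C_\infty^{\log}$ with $\alpha_i(0)=\alpha_{i\infty}$, and define $$\frac1{q(\cdot)}=\sum_{i=1}^m\Big(\frac1{q_i(\cdot)}+\frac1{r_i(\cdot)}\Big),\quad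 \gamma(\cdot)=\sum_{i=1}^m\Big(\gamma_i+\frac{\gamma_i}{r_i(\cdot)}\Big),\quad \alpha^*(\cdot)=\sum_{i=1}^m\Big(\alpha_i(\cdot)-\beta_i-\frac{\gamma_i+n}{r_i(\cdot)}\Big),$$ $\omega_i(x)=|x|^{\gamma_i}$, $\omega(x)=|x|^{\gamma(x)}$. Assume $q\in\mathcal P_b$ and $\alpha^*\in L^\infty\cap\mathbf C_0^{\log}\cap\mathbf C_\infty^{\log}$. Let $\Phi:\mathbb R^n\to[0,\infty)$ and the $n\times n$ real matrix functions $A_i(t)$ be measurable, with $A_i(t)$ invertible for a.e. $t$ with $\Phi(t)\ne0$, and let $b_i\in\mathrm{Lip}^{\beta_i}(\mathbb R^n)$, i.e. $\sup_{x\ne y}|b_i(x)-b_i(y)|/|x-y|^{\beta_i}<\infty$, with $b_i$ complex-valued. Assume that for all $i$ and a.e. $t$ with $\Phi(t)\ne0$ $$q_i(A_i^{-1}(t)x)\le\zeta q_i(x)\ \text{ for a.e. }x,\qquad \|1\|_{L^{\vartheta_i(t,\cdot)}}<\infty,\qquad \frac1{\vartheta_i(t,\cdot)}=\frac1{q_i(A_i^{-1}(t)\cdot)}-\frac1{\zeta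 q_i(\cdot)},$$ and that one of the following holds: (a) $\gamma_i>-n$, $r_i(0)=r_{i+}$, $r_{i\infty}=r_{i-}$ for all $i$; (b) $\gamma_i<-n$, $r_i(0)=r_{i-}$, $r_{i\infty}=r_{i+}$ for all $i$; (c) $\gamma_i=-n$ for all $i$. **Constant.** Let $\Theta_n^*=\Theta_n^*(t)$ be the greatest integer with $\max_{i}\|A_i(t)\|\,\|A_i^{-1}(t)\|<2^{-\Theta_n^*}$, and $$c_{A_i,q_i,\gamma_i}(t)=\max\{\|A_i(t)\|^{-\gamma_i},\|A_i^{-1}(t)\|^{\gamma_i}\}\,\max\{|\det A_i^{-1}(t)|^{1/q_{i+}},|\det A_i^{-1}(t)|^{1/q_{i-}}\},$$ $$\phi_{A_i,0}(t)=\max\{\|A_i(t)\|^{-\alpha_i(0)},\|A_i(t)\|^{-\alpha_{i\infty}}\}\,\max\Big\{\sum_{\rho=\Theta_n^*-1}^{0}2^{-\rho\alpha_i(0)},\sum_{\rho=\Theta_n^*-1}^{0}2^{-\rho\alpha_{i\infty}}\Big\}.$$ **Theorem.** If $$\mathcal C_2=\int_{\mathbb R^n}(2-\Theta_n^*)^{m-\frac1p}\,\frac{\Phi(t)}{|t|^n}\prod_{i=1}^m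 c_{A_i,q_i,\gamma_i}(t)\,\|I_n-A_i(t)\|^{\beta_i}\,\|1\|_{L^{\vartheta_i(t,\cdot)}}\,\phi_{A_i,0}(t)\,dt<\infty ,$$ then the commutator $$H^{\vec b}_{\Phi,\vec A}(\vec f)(x)=\int_{\mathbb R^n}\frac{\Phi(t)}{|t|^n}\prod_{i=1}^m f_i(A_i(t)x)\prod_{i=1}^m\big(b_i(x)-b_i(A_i(t)x)\big)\,dt$$ is a bounded operator from $\dot K^{\alpha_1(\cdot),p_1}_{\zeta q_1(\cdot),\omega_1}\times\dots\times\dot K^{\alpha_m(\cdot),p_m}_{\zeta q_m(\cdot),\omega_m}$ to $\dot K^{\alpha^*(\cdot),p}_{q(\cdot),\omega}$: there is a finite constant $C$ such that, for all $f_i$ in these spaces, the integral converges absolutely for a.e. $x$, $H^{\vec b}_{\Phi,\vec A}(\vec f)\in\dot K^{\alpha^*(\cdot),p}_{q(\cdot),\omega}$, and $$\|H^{\vec b}_{\Phi,\vec A}(\vec f)\|_{\dot K^{\alpha^*(\cdot),p}_{q(\cdot),\omega}}\le C\prod_{i=1}^m\|f_i\|_{\dot K^{\alpha_i(\cdot),p_i}_{\zeta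 q_i(\cdot),\omega_i}} .$$ -/

import Mathlib

open MeasureTheory Filter Topology
open scoped ENNReal NNReal

namespace HausdorffHerz

noncomputable section

/-- The Frobenius norm `(∑ |a_{jk}|²)^{1/2}` of a real matrix. -/
def matNorm {n : ℕ} (A : Matrix (Fin n) (Fin n) ℝ) : ℝ :=
  Real.sqrt (∑ j, ∑ k, (A j k) ^ 2)

/-- The action `A x` of a matrix on a vector of Euclidean space. -/
def act {n : ℕ} (A : Matrix (Fin n) (Fin n) ℝ) (x : EuclideanSpace ℝ (Fin n)) :
    EuclideanSpace ℝ (Fin n) :=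
  WithLp.toLp 2 (A.mulVec x.ofLp)

/-! ### Variable exponents -/

/-- The class of all Lebesgue measurable exponents with values in `[1, ∞]`. -/
structure IsExponent {n : ℕ} (p : EuclideanSpace ℝ (Fin n) → ℝ≥0∞) : Prop where
  aemeasurable : AEMeasurable p volume
  one_le : ∀ x, 1 ≤ p x

/-- The class of exponents with `1 < q₋ ≤ q(x) ≤ q₊ < ∞` for all `x`, where `q₋`, `q₊` are the
essential infimum and the essential supremum. -/
structure IsBoundedExponent {n : ℕ} (q : EuclideanSpace ℝ (Fin n) → ℝ≥0∞) : Prop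
    extends IsExponent q where
  one_lt_essInf : 1 < essInf q volume
  essInf_le : ∀ x, essInf q volume ≤ q x
  le_essSup : ∀ x, q x ≤ essSup q volume
  essSup_lt_top : essSup q volume < ∞

/-- The class of exponents that have the limit `rInf` at infinity. -/
structure IsExponentWithLimit {n : ℕ} (r : EuclideanSpace ℝ (Fin n) → ℝ≥0∞) (rInf : ℝ≥0∞) : Prop
    extends IsExponent r where
  tendsto : Tendsto r (cocompact (EuclideanSpace ℝ (Fin n))) (𝓝 rInf)

/-- Log-Hölder continuity at the origin. -/
def LogHolderAtZero {n : ℕ} (α : EuclideanSpace ℝ (Fin n) → ℝ) : Prop :=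
  ∃ C : ℝ, ∀ x, |α x - α 0| ≤ C / Real.log (Real.exp 1 + 1 / ‖x‖)

/-- Log-Hölder continuity at infinity, with value `αInf` there. -/
def LogHolderAtInfinity {n : ℕ} (α : EuclideanSpace ℝ (Fin n) → ℝ) (αInf : ℝ) : Prop :=
  ∃ C : ℝ, ∀ x, |α x - αInf| ≤ C / Real.log (Real.exp 1 + ‖x‖)

/-! ### Variable exponent Lebesgue and Herz spaces -/

/-- The modular `F_p(f)`: the integral of `|f(x)|^{p(x)}` over `{p < ∞}` plus the essential
supremum of `|f|` over `{p = ∞}`. -/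
def modular {n : ℕ} (p : EuclideanSpace ℝ (Fin n) → ℝ≥0∞) (f : EuclideanSpace ℝ (Fin n) → ℂ) :
    ℝ≥0∞ :=
  (∫⁻ x in {x | p x ≠ ∞}, ‖f x‖ₑ ^ (p x).toReal) +
    eLpNorm f ∞ (volume.restrict {x | p x = ∞})

/-- The Luxemburg norm of `L^{p(·)}`, with value `∞` if no `η > 0` is admissible. -/
def varNorm {n : ℕ} (p : EuclideanSpace ℝ (Fin n) → ℝ≥0∞) (f : EuclideanSpace ℝ (Fin n) → ℂ) :
    ℝ≥0∞ :=
  ⨅ (η : ℝ) (_ : 0 < η) (_ : modular p (fun x => f x / (η : ℂ)) ≤ 1), ENNReal.ofReal η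

/-- The norm of the weighted space `L^{p(·)}_ω`, i.e. the norm of `f ω` in `L^{p(·)}`. -/
def wNorm {n : ℕ} (p : EuclideanSpace ℝ (Fin n) → ℝ≥0∞) (ω : EuclideanSpace ℝ (Fin n) → ℝ)
    (f : EuclideanSpace ℝ (Fin n) → ℂ) : ℝ≥0∞ :=
  varNorm p (fun x => f x * (ω x : ℂ))

/-- The dyadic annulus `C_k = {2^{k-1} < |x| ≤ 2^k}`. -/
def annulus (n : ℕ) (k : ℤ) : Set (EuclideanSpace ℝ (Fin n)) :=
  {x | (2 : ℝ) ^ (k - 1) < ‖x‖ ∧ ‖x‖ ≤ (2 : ℝ) ^ k}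

/-- The norm of the weighted variable exponent Herz space. -/
def herzNorm {n : ℕ} (α : EuclideanSpace ℝ (Fin n) → ℝ) (p : ℝ)
    (q : EuclideanSpace ℝ (Fin n) → ℝ≥0∞) (ω : EuclideanSpace ℝ (Fin n) → ℝ)
    (f : EuclideanSpace ℝ (Fin n) → ℂ) : ℝ≥0∞ :=
  (∑' k : ℤ, wNorm q ω
    ((annulus n k).indicator fun x => (((2 : ℝ) ^ ((k : ℝ) * α x) : ℝ) : ℂ) * f x) ^ p) ^ (1 / p)

/-- Membership in the weighted variable exponent Herz space: `f` is (Lebesgue) measurable, lies in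
`L^{q(·)}_loc(ℝⁿ ∖ {0})`, and has finite Herz norm. -/
structure MemHerz {n : ℕ} (α : EuclideanSpace ℝ (Fin n) → ℝ) (p : ℝ)
    (q : EuclideanSpace ℝ (Fin n) → ℝ≥0∞) (ω : EuclideanSpace ℝ (Fin n) → ℝ)
    (f : EuclideanSpace ℝ (Fin n) → ℂ) : Prop where
  aestronglyMeasurable : AEStronglyMeasurable f volume
  locally : ∀ K : Set (EuclideanSpace ℝ (Fin n)), IsCompact K → 0 ∉ K →
    varNorm q (K.indicator f) < ∞
  norm_lt_top : herzNorm α p q ω f < ∞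

/-! ### The commutator -/

/-- The integrand of the commutator of the multilinear Hausdorff operator. -/
def commIntegrand {n m : ℕ} (Φ : EuclideanSpace ℝ (Fin n) → ℝ)
    (A : Fin m → EuclideanSpace ℝ (Fin n) → Matrix (Fin n) (Fin n) ℝ)
    (b f : Fin m → EuclideanSpace ℝ (Fin n) → ℂ) (x t : EuclideanSpace ℝ (Fin n)) : ℂ :=
  ((Φ t / ‖t‖ ^ n : ℝ) : ℂ) * (∏ i, f i (act (A i t) x)) *
    ∏ i, (b i x - b i (act (A i t) x))

/-- The Coifman-Rochberg-Weiss type commutator of the multilinear Hausdorff operator. -/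
def hausdorffCommutator {n m : ℕ} (Φ : EuclideanSpace ℝ (Fin n) → ℝ)
    (A : Fin m → EuclideanSpace ℝ (Fin n) → Matrix (Fin n) (Fin n) ℝ)
    (b f : Fin m → EuclideanSpace ℝ (Fin n) → ℂ) (x : EuclideanSpace ℝ (Fin n)) : ℂ :=
  ∫ t, commIntegrand Φ A b f x t

/-! ### The parameters of the target space -/

/-- `1/q = ∑ 1/q_i + ∑ 1/r_i`. -/
def qTarget {n m : ℕ} (q r : Fin m → EuclideanSpace ℝ (Fin n) → ℝ≥0∞)
    (x : EuclideanSpace ℝ (Fin n)) : ℝ≥0∞ :=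
  (∑ i, (q i x)⁻¹ + ∑ i, (r i x)⁻¹)⁻¹

/-- `γ(x) = ∑ γ_i + ∑ γ_i / r_i(x)`. -/
def gammaTarget {n m : ℕ} (γ : Fin m → ℝ) (r : Fin m → EuclideanSpace ℝ (Fin n) → ℝ≥0∞)
    (x : EuclideanSpace ℝ (Fin n)) : ℝ :=
  ∑ i, γ i + ∑ i, γ i * ((r i x)⁻¹).toReal

/-- `α^*(x) = ∑ α_i(x) - ∑ β_i - ∑ (γ_i + n) / r_i(x)`. -/
def alphaStar {n m : ℕ} (α : Fin m → EuclideanSpace ℝ (Fin n) → ℝ) (β γ : Fin m → ℝ)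
    (r : Fin m → EuclideanSpace ℝ (Fin n) → ℝ≥0∞) (x : EuclideanSpace ℝ (Fin n)) : ℝ :=
  ∑ i, α i x - ∑ i, β i - ∑ i, (γ i + n) * ((r i x)⁻¹).toReal

/-! ### The ingredients of the constant -/

/-- The exponent `ϑ` with `1/ϑ(x) = 1/q(A⁻¹x) - 1/(ζ q(x))`, where `1/∞ = 0`. -/
def theta {n : ℕ} (ζ : ℝ) (q : EuclideanSpace ℝ (Fin n) → ℝ≥0∞) (A : Matrix (Fin n) (Fin n) ℝ)
    (x : EuclideanSpace ℝ (Fin n)) : ℝ≥0∞ :=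
  ((q (act A⁻¹ x))⁻¹ - (ENNReal.ofReal ζ * q x)⁻¹)⁻¹

/-- The greatest integer `Θ` with `max_i ‖A_i‖ ‖A_i⁻¹‖ < 2^{-Θ}`. -/
def thetaStar {n m : ℕ} (A : Fin m → Matrix (Fin n) (Fin n) ℝ) : ℤ :=
  sSup {k : ℤ | ∀ i, matNorm (A i) * matNorm (A i)⁻¹ < (2 : ℝ) ^ (-k)}

/-- The factor `c_{A,q,γ}`. -/
def cFactor {n : ℕ} (A : Matrix (Fin n) (Fin n) ℝ) (q : EuclideanSpace ℝ (Fin n) → ℝ≥0∞)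
    (γ : ℝ) : ℝ :=
  max (matNorm A ^ (-γ)) (matNorm A⁻¹ ^ γ) *
    max (|A⁻¹.det| ^ (1 / (essSup q volume).toReal)) (|A⁻¹.det| ^ (1 / (essInf q volume).toReal))

/-- The factor `φ_{A,λ}`, with `α0 = α(0)`, `αInf = α_∞` and `Θ` the integer `thetaStar`. -/
def phiFactor {n : ℕ} (A : Matrix (Fin n) (Fin n) ℝ) (Θ : ℤ) (lam α0 αInf : ℝ) : ℝ :=
  max (matNorm A ^ (lam - α0)) (matNorm A ^ (lam - αInf)) *
    max (∑ r ∈ Finset.Icc (Θ - 1) 0, (2 : ℝ) ^ ((r : ℝ) * (lam - α0)))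
      (∑ r ∈ Finset.Icc (Θ - 1) 0, (2 : ℝ) ^ ((r : ℝ) * (lam - αInf)))

/-- The constant `𝒞₂`, an integral of a nonnegative function. -/
def constC2 {n m : ℕ} (Φ : EuclideanSpace ℝ (Fin n) → ℝ)
    (A : Fin m → EuclideanSpace ℝ (Fin n) → Matrix (Fin n) (Fin n) ℝ) (ζ p : ℝ)
    (q : Fin m → EuclideanSpace ℝ (Fin n) → ℝ≥0∞) (β γ : Fin m → ℝ)
    (α : Fin m → EuclideanSpace ℝ (Fin n) → ℝ) (αInf : Fin m → ℝ) : ℝ≥0∞ :=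
  ∫⁻ t, ENNReal.ofReal
      ((2 - (thetaStar fun i => A i t : ℝ)) ^ ((m : ℝ) - 1 / p) * (Φ t / ‖t‖ ^ n)) *
    ∏ i, (ENNReal.ofReal (cFactor (A i t) (q i) (γ i) * matNorm (1 - A i t) ^ β i) *
      varNorm (theta ζ (q i) (A i t)) (fun _ => 1) *
      ENNReal.ofReal (phiFactor (A i t) (thetaStar fun i => A i t) 0 (α i 0) (αInf i)))

end

end HausdorffHerz

open HausdorffHerz

/-!
The commutator is a superposition over `t` of products of the functions `f_i(A_i(t) x)`, so its norm
is estimated by Minkowski's integral inequality once the integrand is estimated for fixed `t`.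

All norms are Luxemburg norms of `[0, ∞]`-valued functions over a measure space (`lux`); over the
counting measure of `ℤ` with a constant exponent they are the norms of `ℓ^p`, so that a Herz norm is
a Luxemburg norm of Luxemburg norms (`herzNorm_eq_lux`). The two inequalities that are needed hold
at this generality: Hölder's inequality with the number of factors as the constant (`lux_prod_le`),
and Minkowski's integral inequality for exponents `≥ 1` (`lux_lintegral_le`), which is Jensen's
inequality for the probability measure whose density is proportional to the norm of the integrand.

For fixed `t`, on the annulus `C_k`, the Hölder condition bounds `|b_i(x) - b_i(A_i x)|` by a
multiple of `‖1 - A_i‖ ^ β_i 2 ^ (k β_i)`. The exponents `α^*` and `γ(·)` are such that the target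
weight times `∏ 2 ^ (k β_i)` is exactly the product of the weights `2 ^ (k α_i) |x| ^ γ_i` and of
`2 ^ (-k (γ_i + n) / r_i) |x| ^ (γ_i / r_i)` (`target_weight_eq`). The norms of the latter in
`L^{r_i(·)}(C_k)` are bounded uniformly in `k`, since `2 ^ (-k (γ_i + n)) |x| ^ γ_i` has bounded
integral over `C_k` (`exists_lux_rPiece_le`). Hölder's inequality therefore leaves the norms
of `2 ^ (k α_i) |x| ^ γ_i f_i(A_i x)` in `L^{q_i(·)}(C_k)`.

For these, log-Hölder continuity with `α_i(0) = α_{i∞}` makes `2 ^ (k α_i(x))` comparable to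
`2 ^ (k α_i(0))` uniformly in `k` (`exists_abs_mul_sub_le`), and `A_i` maps `C_k` into the union of the
annuli `C_{k+l+ρ}` with `2 ^ (l-1) < ‖A_i‖ ≤ 2 ^ l` and `Θ - 1 ≤ ρ ≤ 0`
(`exists_act_mem_annulus`). A change of variables turns the exponent `q_i` into `q_i(A_i⁻¹ ·)`, and
Hölder's inequality with the exponent `ϑ_i` passes from there to `ζ q_i` (`lux_comp_act_le`). Hölder's
inequality and the triangle inequality for sequences in `k` then give the integrand of `constC2`.
-/

namespace HausdorffHerz

/-! ### Luxemburg norms of nonnegative functions -/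

section Luxemburg

variable {X T : Type*} [MeasurableSpace X] [MeasurableSpace T]

/-- The modular of `L^{p(·)}(μ)` on `[0, ∞]`-valued functions. -/
noncomputable def emodular (μ : Measure X) (p g : X → ℝ≥0∞) : ℝ≥0∞ :=
  (∫⁻ x in {x | p x ≠ ∞}, g x ^ (p x).toReal ∂μ) + essSup g (μ.restrict {x | p x = ∞})

/-- The Luxemburg norm of `L^{p(·)}(μ)` on `[0, ∞]`-valued functions. Besides Lebesgue measure, the
counting measure on `ℤ` is used, where it is the norm of a sequence space. -/
noncomputable def lux (μ : Measure X) (p g : X → ℝ≥0∞) : ℝ≥0∞ :=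
  ⨅ (η : ℝ) (_ : 0 < η) (_ : emodular μ p (fun x => g x / ENNReal.ofReal η) ≤ 1), ENNReal.ofReal η

variable {μ : Measure X} {p p' g g' : X → ℝ≥0∞}

theorem emodular_mono (h : g ≤ᵐ[μ] g') : emodular μ p g ≤ emodular μ p g' := by
  refine add_le_add (lintegral_mono_ae ?_) (essSup_mono_ae (ae_restrict_of_ae h))
  filter_upwards [ae_restrict_of_ae h] with x hx
  exact ENNReal.rpow_le_rpow hx ENNReal.toReal_nonneg

theorem emodular_congr_exponent (h : p =ᵐ[μ] p') : emodular μ p g = emodular μ p' g := by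
  unfold emodular
  have h1 : μ.restrict {x | p x ≠ ∞} = μ.restrict {x | p' x ≠ ∞} :=
    Measure.restrict_congr_set (by filter_upwards [h] with x hx; exact propext (by
      change p x ≠ ∞ ↔ p' x ≠ ∞; rw [hx]))
  have h2 : μ.restrict {x | p x = ∞} = μ.restrict {x | p' x = ∞} :=
    Measure.restrict_congr_set (by filter_upwards [h] with x hx; exact propext (by
      change p x = ∞ ↔ p' x = ∞; rw [hx]))
  rw [h1, h2]
  congr 1
  refine lintegral_congr_ae ?_
  filter_upwards [ae_restrict_of_ae h] with x hx
  rw [hx]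

theorem emodular_of_ne_top (hp : ∀ x, p x ≠ ∞) :
    emodular μ p g = ∫⁻ x, g x ^ (p x).toReal ∂μ := by
  have h1 : {x | p x ≠ ∞} = Set.univ := Set.eq_univ_of_forall hp
  have h2 : {x | p x = ∞} = ∅ := Set.eq_empty_of_forall_notMem hp
  simp [emodular, h1, h2]

theorem lux_le_ofReal {η : ℝ} (hη : 0 < η)
    (h : emodular μ p (fun x => g x / ENNReal.ofReal η) ≤ 1) : lux μ p g ≤ ENNReal.ofReal η :=
  iInf_le_of_le η (iInf_le_of_le hη (iInf_le _ h))

theorem emodular_div_le_of_lux_lt {c : ℝ≥0∞} (h : lux μ p g < c) :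
    emodular μ p (fun x => g x / c) ≤ 1 := by
  simp only [lux, iInf_lt_iff] at h
  obtain ⟨η, hη, h1, h2⟩ := h
  exact (emodular_mono (ae_of_all _ fun x => ENNReal.div_le_div_left h2.le _)).trans h1

theorem lux_le_of_emodular_le {c : ℝ≥0∞} (h : emodular μ p (fun x => g x / c) ≤ 1) :
    lux μ p g ≤ c := by
  refine le_of_forall_gt_imp_ge_of_dense fun d hd => ?_
  rcases eq_or_ne d ∞ with rfl | hd'
  · exact le_top
  · have h0 : 0 < d := zero_le.trans_lt hd
    rw [← ENNReal.ofReal_toReal hd']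
    refine lux_le_ofReal (ENNReal.toReal_pos h0.ne' hd') ?_
    rw [ENNReal.ofReal_toReal hd']
    exact (emodular_mono (ae_of_all _ fun x => ENNReal.div_le_div_left hd.le _)).trans h

theorem lux_mono (h : g ≤ᵐ[μ] g') : lux μ p g ≤ lux μ p g' := by
  refine le_of_forall_gt_imp_ge_of_dense fun d hd => lux_le_of_emodular_le ?_
  refine (emodular_mono ?_).trans (emodular_div_le_of_lux_lt hd)
  filter_upwards [h] with x hx
  exact ENNReal.div_le_div_right hx _

theorem lux_congr (h : g =ᵐ[μ] g') : lux μ p g = lux μ p g' :=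
  le_antisymm (lux_mono h.le) (lux_mono h.symm.le)

theorem lux_congr_exponent (h : p =ᵐ[μ] p') : lux μ p g = lux μ p' g := by
  simp only [lux, emodular_congr_exponent h]

theorem lux_zero (hp : ∀ x, p x ≠ 0) (hpt : ∀ x, p x ≠ ∞) : lux μ p (fun _ => 0) = 0 := by
  refine le_antisymm (lux_le_of_emodular_le ?_) zero_le
  have h (x : X) : (0 : ℝ≥0∞) ^ (p x).toReal = 0 :=
    ENNReal.zero_rpow_of_pos (ENNReal.toReal_pos (hp x) (hpt x))
  simp [emodular_of_ne_top hpt, h]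

theorem lux_const_mul_le (hp : ∀ x, p x ≠ 0) (hpt : ∀ x, p x ≠ ∞) {c : ℝ≥0∞} (hc : c ≠ ∞) :
    lux μ p (fun x => c * g x) ≤ c * lux μ p g := by
  rcases eq_or_ne c 0 with rfl | hc0
  · simp [lux_zero hp hpt]
  rw [mul_comm, ← ENNReal.div_le_iff hc0 hc]
  refine le_of_forall_gt_imp_ge_of_dense fun d hd => ?_
  rw [ENNReal.div_le_iff hc0 hc]
  refine lux_le_of_emodular_le ((emodular_mono (ae_of_all _ fun x => ?_)).trans
    (emodular_div_le_of_lux_lt hd))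
  rw [mul_comm d c, ENNReal.mul_div_mul_left _ _ hc0 hc]

theorem lux_const {s : ℝ} (hs : 0 < s) :
    lux μ (fun _ => ENNReal.ofReal s) g = (∫⁻ x, g x ^ s ∂μ) ^ (1 / s) := by
  have key (η : ℝ≥0∞) (h0 : η ≠ 0) (ht : η ≠ ∞) :
      emodular μ (fun _ => ENNReal.ofReal s) (fun x => g x / η) = (∫⁻ x, g x ^ s ∂μ) / η ^ s := by
    rw [emodular_of_ne_top (by simp)]
    simp only [ENNReal.toReal_ofReal hs.le, div_eq_mul_inv, ENNReal.mul_rpow_of_nonneg _ _ hs.le]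
    rw [lintegral_mul_const' _ _ (by simp [h0, ht, hs]), ENNReal.inv_rpow]
  refine le_antisymm ?_ ?_
  · refine le_of_forall_gt_imp_ge_of_dense fun d hd => ?_
    rcases eq_or_ne d ∞ with rfl | ht
    · exact le_top
    have h0 : d ≠ 0 := (zero_le.trans_lt hd).ne'
    refine lux_le_of_emodular_le ?_
    rw [key d h0 ht]
    refine ENNReal.div_le_of_le_mul ?_
    rw [one_mul]
    rw [one_div, ENNReal.rpow_inv_lt_iff hs] at hd
    exact hd.le
  · refine le_iInf fun η => le_iInf fun hη => le_iInf fun h => ?_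
    have h0 : ENNReal.ofReal η ≠ 0 := by simpa using hη
    rw [key _ h0 ENNReal.ofReal_ne_top, ENNReal.div_le_iff (by simp [hη])
      (by simp [hs.le]), one_mul] at h
    rwa [one_div, ENNReal.rpow_inv_le_iff hs]

/-! ### Hölder's inequality -/

/-- The pointwise form of Hölder's inequality. The exponents that are infinite at a point contribute
a factor at most one there, and the remaining weights `s / s_i` sum to one, so that the weighted
product is bounded by the sum of the modular densities. -/
theorem prod_rpow_le_sum_indicator {ι : Type*} [Fintype ι] {s : ℝ≥0∞} {e y : ι → ℝ≥0∞}
    (hs1 : 1 ≤ s) (hst : s ≠ ∞) (hse : s⁻¹ = ∑ i, (e i)⁻¹) (hy : ∀ i, e i = ∞ → y i ≤ 1) :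
    (∏ i, y i) ^ s.toReal ≤ ∑ i, if e i = ∞ then 0 else y i ^ (e i).toReal := by
  classical
  have hs0 : s ≠ 0 := (zero_lt_one.trans_le hs1).ne'
  have hspos : 0 < s.toReal := ENNReal.toReal_pos hs0 hst
  have he0 (i) : e i ≠ 0 := fun h => by
    have h1 : (e i)⁻¹ ≤ s⁻¹ := hse ▸ Finset.single_le_sum (f := fun i => (e i)⁻¹)
      (fun _ _ => zero_le) (Finset.mem_univ i)
    simp [h, hs0] at h1
  set J : Finset ι := Finset.univ.filter fun i => e i ≠ ∞ with hJ
  have h1 : ∏ i, y i ≤ ∏ i ∈ J, y i := by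
    rw [← Finset.prod_filter_mul_prod_filter_not Finset.univ (fun i => e i ≠ ∞)]
    refine mul_le_of_le_one_right' (Finset.prod_le_one' fun i hi => hy i ?_)
    simpa using hi
  have hsum : ∑ i ∈ J, s.toReal / (e i).toReal = 1 := by
    have h2 : s⁻¹ = ∑ i ∈ J, (e i)⁻¹ := by
      rw [hse, hJ, Finset.sum_filter]
      refine Finset.sum_congr rfl fun i _ => ?_
      by_cases h : e i = ∞ <;> simp [h]
    have h3 : s.toReal⁻¹ = ∑ i ∈ J, (e i).toReal⁻¹ := by
      rw [← ENNReal.toReal_inv, h2, ENNReal.toReal_sum (fun i _ => by simp [he0 i])]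
      simp
    simp only [div_eq_mul_inv]
    rw [← Finset.mul_sum, ← h3, mul_inv_cancel₀ hspos.ne']
  have hsumJ : ∑ i, (if e i = ∞ then 0 else y i ^ (e i).toReal) =
      ∑ i ∈ J, y i ^ (e i).toReal := by
    rw [hJ, Finset.sum_filter]
    refine Finset.sum_congr rfl fun i _ => ?_
    by_cases h : e i = ∞ <;> simp [h]
  rw [hsumJ]
  set Y := ∑ i ∈ J, y i ^ (e i).toReal with hY
  have hpow (w : ι → ℝ) (hw : ∀ i, 0 ≤ w i) (K : Finset ι) :
      ∏ i ∈ K, Y ^ w i = Y ^ ∑ i ∈ K, w i := by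
    induction K using Finset.induction_on with
    | empty => simp
    | insert a K ha ih =>
      rw [Finset.prod_insert ha, Finset.sum_insert ha, ih,
        ENNReal.rpow_add_of_nonneg _ _ (hw a) (Finset.sum_nonneg fun i _ => hw i)]
  calc (∏ i, y i) ^ s.toReal ≤ (∏ i ∈ J, y i) ^ s.toReal := ENNReal.rpow_le_rpow h1 hspos.le
    _ = ∏ i ∈ J, (y i ^ (e i).toReal) ^ (s.toReal / (e i).toReal) := by
      rw [← ENNReal.prod_rpow_of_nonneg hspos.le]
      refine Finset.prod_congr rfl fun i hi => ?_
      have : 0 < (e i).toReal := ENNReal.toReal_pos (he0 i) (by simpa [hJ] using hi)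
      rw [← ENNReal.rpow_mul, mul_div_cancel₀ _ this.ne']
    _ ≤ ∏ i ∈ J, Y ^ (s.toReal / (e i).toReal) := by
      refine Finset.prod_le_prod' fun i hi => ENNReal.rpow_le_rpow ?_ (by positivity)
      exact Finset.single_le_sum (f := fun i => y i ^ (e i).toReal) (fun _ _ => zero_le) hi
    _ = Y := by rw [hpow _ (fun i => by positivity), hsum, ENNReal.rpow_one]

/-- Hölder's inequality on the unit balls of the modulars. -/
theorem emodular_prod_div_card_le {ι : Type*} [Fintype ι] [Nonempty ι] {s : X → ℝ≥0∞}
    {e g : ι → X → ℝ≥0∞} (hs1 : ∀ x, 1 ≤ s x) (hst : ∀ x, s x ≠ ∞)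
    (hse : ∀ᵐ x ∂μ, (s x)⁻¹ = ∑ i, (e i x)⁻¹) (he : ∀ i, AEMeasurable (e i) μ)
    (hg : ∀ i, AEMeasurable (g i) μ) (h : ∀ i, emodular μ (e i) (g i) ≤ 1) :
    emodular μ s (fun x => (∏ i, g i x) / Fintype.card ι) ≤ 1 := by
  have hc1 : (1 : ℝ≥0∞) ≤ Fintype.card ι := by exact_mod_cast Fintype.card_pos (α := ι)
  have hnull (i) : NullMeasurableSet {x | e i x = ∞} μ :=
    (he i).nullMeasurableSet_preimage (measurableSet_singleton ∞)
  have htop (i) : ∀ᵐ x ∂μ, e i x = ∞ → g i x ≤ 1 := by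
    have h1 : ∀ᵐ x ∂μ.restrict {x | e i x = ∞}, g i x ≤ 1 := by
      filter_upwards [ae_le_essSup (f := g i) (μ := μ.restrict {x | e i x = ∞})] with x hx
      exact hx.trans (le_add_self.trans (h i))
    exact (ae_restrict_iff'₀ (hnull i)).1 h1
  rw [emodular_of_ne_top hst]
  calc ∫⁻ x, ((∏ i, g i x) / Fintype.card ι) ^ (s x).toReal ∂μ
      ≤ ∫⁻ x, (Fintype.card ι : ℝ≥0∞)⁻¹ *
          ∑ i, (if e i x = ∞ then 0 else g i x ^ (e i x).toReal) ∂μ := by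
        refine lintegral_mono_ae ?_
        filter_upwards [hse, ae_all_iff.2 htop] with x hx hx'
        have h1 : 1 ≤ (s x).toReal := by
          simpa using ENNReal.toReal_mono (hst x) (hs1 x)
        rw [div_eq_mul_inv, mul_comm, ENNReal.mul_rpow_of_nonneg _ _ (by positivity)]
        refine mul_le_mul' ?_ (prod_rpow_le_sum_indicator (hs1 x) (hst x) hx hx')
        exact ENNReal.rpow_le_self_of_le_one (ENNReal.inv_le_one.2 hc1) h1
    _ = (Fintype.card ι : ℝ≥0∞)⁻¹ *
          ∑ i, ∫⁻ x, (if e i x = ∞ then 0 else g i x ^ (e i x).toReal) ∂μ := by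
        rw [lintegral_const_mul' _ _ (by simp), lintegral_finsetSum']
        intro i _
        have h2 : AEMeasurable (fun x => g i x ^ (e i x).toReal) μ :=
          (hg i).pow (he i).ennreal_toReal
        convert h2.indicator₀ (hnull i).compl using 2 with x
        simp [Set.indicator_apply]
    _ ≤ (Fintype.card ι : ℝ≥0∞)⁻¹ * ∑ i : ι, 1 := by
        gcongr with i
        refine le_trans ?_ (h i)
        refine le_trans (le_of_eq ?_) le_self_add
        have h3 : {x | e i x ≠ ∞} = {x | e i x = ∞}ᶜ := rfl
        rw [h3, ← lintegral_indicator₀ (hnull i).compl]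
        refine lintegral_congr fun x => ?_
        simp [Set.indicator_apply]
    _ = 1 := by
        simp only [Finset.sum_const, Finset.card_univ, nsmul_eq_mul, mul_one]
        exact ENNReal.inv_mul_cancel (zero_lt_one.trans_le hc1).ne' (by simp)

/-- Hölder's inequality for variable exponents, with the number of factors as the constant. -/
theorem lux_prod_le {ι : Type*} [Fintype ι] [Nonempty ι] {s : X → ℝ≥0∞}
    {e g : ι → X → ℝ≥0∞} (hs1 : ∀ x, 1 ≤ s x) (hst : ∀ x, s x ≠ ∞)
    (hse : ∀ᵐ x ∂μ, (s x)⁻¹ = ∑ i, (e i x)⁻¹) (he : ∀ i, AEMeasurable (e i) μ)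
    (hg : ∀ i, AEMeasurable (g i) μ) (h : ∀ i, lux μ (e i) (g i) ≠ ∞) :
    lux μ s (fun x => ∏ i, g i x) ≤ Fintype.card ι * ∏ i, lux μ (e i) (g i) := by
  have key (ε : ℝ≥0∞) (hε : 0 < ε) (hεt : ε ≠ ∞) : lux μ s (fun x => ∏ i, g i x) ≤
      Fintype.card ι * ∏ i, (lux μ (e i) (g i) + ε) := by
    have h1 (i) : emodular μ (e i) (fun x => g i x / (lux μ (e i) (g i) + ε)) ≤ 1 :=
      emodular_div_le_of_lux_lt (ENNReal.lt_add_right (h i) hε.ne')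
    have h2 := emodular_prod_div_card_le hs1 hst hse he
      (fun i => (hg i).div_const (lux μ (e i) (g i) + ε)) h1
    refine lux_le_of_emodular_le (le_trans (le_of_eq ?_) h2)
    congr 1
    ext x
    simp only [div_eq_mul_inv, Finset.prod_mul_distrib]
    rw [ENNReal.mul_inv (by simp) (by simp), ENNReal.prod_inv_distrib, mul_assoc,
      mul_comm (∏ i, (lux μ (e i) (g i) + ε)⁻¹)]
    intro i _ j _ _
    exact Or.inl (by simp [hε.ne'])
  have hlim : Tendsto (fun ε : ℝ≥0∞ => (Fintype.card ι : ℝ≥0∞) * ∏ i, (lux μ (e i) (g i) + ε))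
      (𝓝[>] 0) (𝓝 (Fintype.card ι * ∏ i, (lux μ (e i) (g i) + 0))) := by
    refine Tendsto.mono_left ?_ nhdsWithin_le_nhds
    refine ENNReal.Tendsto.const_mul ?_ (Or.inr (by simp))
    refine ENNReal.tendsto_finsetProd_of_ne_top _ (fun i _ => ?_) (by simpa using h)
    exact tendsto_const_nhds.add tendsto_id
  simp only [add_zero] at hlim
  refine ge_of_tendsto hlim ?_
  filter_upwards [self_mem_nhdsWithin, mem_nhdsWithin_of_mem_nhds
    (Iio_mem_nhds ENNReal.zero_lt_top)] with ε h1 h2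
  exact key ε h1 (ne_of_lt h2)

end Luxemburg

/-! ### Minkowski's integral inequality -/

section Minkowski

variable {X T : Type*} [MeasurableSpace X] [MeasurableSpace T]
variable {μ : Measure X} {ν : Measure T} {p : X → ℝ≥0∞} {G : T → X → ℝ≥0∞}

theorem rpow_lintegral_le_lintegral_rpow [IsProbabilityMeasure ν] {h : T → ℝ≥0∞}
    (hh : AEMeasurable h ν) {s : ℝ} (hs : 1 ≤ s) :
    (∫⁻ t, h t ∂ν) ^ s ≤ ∫⁻ t, h t ^ s ∂ν := by
  have h1 := eLpNorm'_le_eLpNorm'_of_exponent_le (f := h) zero_lt_one hs ν hh.aestronglyMeasurable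
  simp only [eLpNorm', enorm_eq_self, ENNReal.rpow_one, div_one] at h1
  rwa [one_div, ENNReal.le_rpow_inv_iff (by linarith)] at h1

theorem measurable_lux [SFinite μ] (hp : Measurable p) (hpt : ∀ x, p x ≠ ∞)
    (hG : Measurable (Function.uncurry G)) : Measurable fun t => lux μ p (G t) := by
  refine measurable_of_Iio fun c => ?_
  have h1 : (fun t => lux μ p (G t)) ⁻¹' Set.Iio c = ⋃ (η : ℚ) (_ : 0 < η)
      (_ : ENNReal.ofReal (η : ℝ) < c),
        {t | emodular μ p (fun x => G t x / ENNReal.ofReal (η : ℝ)) ≤ 1} := by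
    ext t
    simp only [Set.mem_preimage, Set.mem_Iio, Set.mem_iUnion, Set.mem_ofPred_eq, exists_prop]
    constructor
    · intro h
      obtain ⟨η, h0, h2, h3⟩ := ENNReal.lt_iff_exists_rat_btwn.1 h
      have hη : (0 : ℝ) < η := by
        by_contra! hneg
        rw [Real.toNNReal_of_nonpos hneg] at h2
        simp at h2
      exact ⟨η, by exact_mod_cast hη, h3, emodular_div_le_of_lux_lt h2⟩
    · rintro ⟨η, h0, h2, h3⟩
      exact (lux_le_of_emodular_le h3).trans_lt h2
  rw [h1]
  refine MeasurableSet.iUnion fun η => MeasurableSet.iUnion fun _ => MeasurableSet.iUnion fun _ => ?_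
  refine measurableSet_le ?_ measurable_const
  simp only [emodular_of_ne_top hpt]
  refine Measurable.lintegral_prod_right' (f := fun z : T × X =>
    (G z.1 z.2 / ENNReal.ofReal (η : ℝ)) ^ (p z.2).toReal) ?_
  exact (hG.div_const _).pow (hp.comp measurable_snd).ennreal_toReal

/-- Minkowski's inequality with a strict majorant `N` of the norms. With respect to the probability
measure `(N / Λ) ν` the function `∫ G dν / Λ` is the mean of `G / N`, whose sections are
in the unit ball, and Jensen's inequality applies. -/
theorem lux_lintegral_le_of_lt [SFinite μ] [SFinite ν] (hp : Measurable p) (hp1 : ∀ x, 1 ≤ p x)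
    (hpt : ∀ x, p x ≠ ∞) (hG : Measurable (Function.uncurry G)) {N : T → ℝ≥0∞} (hN : Measurable N)
    (hGN : ∀ᵐ t ∂ν, lux μ p (G t) < N t) (hΛ : ∫⁻ t, N t ∂ν ≠ ∞) :
    lux μ p (fun x => ∫⁻ t, G t x ∂ν) ≤ ∫⁻ t, N t ∂ν := by
  rcases eq_or_ne (∫⁻ t, N t ∂ν) 0 with h0 | h0
  · have hν : ν = 0 := by
      rw [lintegral_eq_zero_iff hN] at h0
      rw [← ae_eq_bot, ← Filter.eventually_false_iff_eq_bot]
      filter_upwards [h0, hGN] with t h1 h2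
      simp [h1] at h2
    subst hν
    simp [lux_zero (μ := μ) (fun x => (zero_lt_one.trans_le (hp1 x)).ne') hpt]
  set Λ := ∫⁻ t, N t ∂ν with hΛdef
  set ν' := ν.withDensity fun t => N t / Λ with hν'
  have hNΛ : Measurable fun t => N t / Λ := hN.div_const _
  have hprob : IsProbabilityMeasure ν' := ⟨by
    rw [hν', withDensity_apply _ MeasurableSet.univ, Measure.restrict_univ]
    simp only [div_eq_mul_inv]
    rw [lintegral_mul_const _ hN, ← hΛdef, ENNReal.mul_inv_cancel h0 hΛ]⟩
  have hNt : ∀ᵐ t ∂ν, N t ≠ ∞ := by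
    filter_upwards [ae_lt_top hN hΛ] with t ht using ht.ne
  have hQ : Measurable fun z : T × X => G z.1 z.2 / N z.1 := hG.div (hN.comp measurable_fst)
  refine lux_le_of_emodular_le ?_
  rw [emodular_of_ne_top hpt]
  calc ∫⁻ x, ((∫⁻ t, G t x ∂ν) / Λ) ^ (p x).toReal ∂μ
      = ∫⁻ x, (∫⁻ t, G t x / N t ∂ν') ^ (p x).toReal ∂μ := by
        refine lintegral_congr fun x => ?_
        congr 1
        have hGx : Measurable fun t => G t x := hG.comp measurable_prodMk_right
        have hGN' : Measurable fun t => G t x / N t := hGx.div hN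
        rw [hν', lintegral_withDensity_eq_lintegral_mul _ hNΛ hGN', div_eq_mul_inv,
          ← lintegral_mul_const _ hGx]
        refine lintegral_congr_ae ?_
        filter_upwards [hNt, hGN] with t h1 h2
        have h3 : N t ≠ 0 := (zero_le.trans_lt h2).ne'
        simp only [Pi.mul_apply, div_eq_mul_inv]
        rw [mul_comm (N t), mul_assoc, ← mul_assoc (N t), mul_comm (N t) (G t x), mul_assoc (G t x),
          ENNReal.mul_inv_cancel h3 h1, mul_one, mul_comm]
    _ ≤ ∫⁻ x, ∫⁻ t, (G t x / N t) ^ (p x).toReal ∂ν' ∂μ := by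
        refine lintegral_mono fun x => rpow_lintegral_le_lintegral_rpow
          (hQ.comp measurable_prodMk_right).aemeasurable ?_
        simpa using ENNReal.toReal_mono (hpt x) (hp1 x)
    _ = ∫⁻ t, ∫⁻ x, (G t x / N t) ^ (p x).toReal ∂μ ∂ν' := by
        refine lintegral_lintegral_swap (f := fun x t => (G t x / N t) ^ (p x).toReal) ?_
        exact ((hQ.comp measurable_swap).pow
          (hp.comp measurable_fst).ennreal_toReal).aemeasurable
    _ ≤ ∫⁻ t, 1 ∂ν' := by
        refine lintegral_mono_ae ?_
        filter_upwards [(withDensity_absolutelyContinuous ν _).ae_le hGN] with t ht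
        have := emodular_div_le_of_lux_lt ht
        rwa [emodular_of_ne_top hpt] at this
    _ = 1 := by simp

theorem exists_measurable_exponent (hp : AEMeasurable p μ) (hp1 : ∀ x, 1 ≤ p x)
    (hpt : ∀ x, p x ≠ ∞) :
    ∃ p' : X → ℝ≥0∞, Measurable p' ∧ (∀ x, 1 ≤ p' x) ∧ (∀ x, p' x ≠ ∞) ∧ p =ᵐ[μ] p' := by
  have h := hp.ennreal_toReal
  refine ⟨fun x => max 1 (ENNReal.ofReal (h.mk _ x)),
    measurable_const.max h.measurable_mk.ennreal_ofReal, fun x => le_max_left _ _,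
    fun x => by simp, ?_⟩
  filter_upwards [h.ae_eq_mk] with x hx
  rw [← hx, ENNReal.ofReal_toReal (hpt x), max_eq_right (hp1 x)]

theorem aemeasurable_lux [SFinite μ] [SFinite ν] (hp : AEMeasurable p μ) (hp1 : ∀ x, 1 ≤ p x)
    (hpt : ∀ x, p x ≠ ∞) (hG : AEMeasurable (Function.uncurry G) (ν.prod μ)) :
    AEMeasurable (fun t => lux μ p (G t)) ν := by
  obtain ⟨p', h1, h2, h3, h4⟩ := exists_measurable_exponent hp hp1 hpt
  refine ⟨fun t => lux μ p' (fun x => hG.mk _ (t, x)),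
    measurable_lux h1 h3 (G := fun t x => hG.mk _ (t, x)) hG.measurable_mk, ?_⟩
  filter_upwards [Measure.ae_ae_of_ae_prod hG.ae_eq_mk] with t ht
  rw [lux_congr_exponent h4]
  exact lux_congr ht

/-- Minkowski's integral inequality for variable exponents. -/
theorem lux_lintegral_le [SFinite μ] [SigmaFinite ν] (hp : AEMeasurable p μ) (hp1 : ∀ x, 1 ≤ p x)
    (hpt : ∀ x, p x ≠ ∞) (hG : AEMeasurable (Function.uncurry G) (ν.prod μ)) :
    lux μ p (fun x => ∫⁻ t, G t x ∂ν) ≤ ∫⁻ t, lux μ p (G t) ∂ν := by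
  obtain ⟨p', h1, h2, h3, h4⟩ := exists_measurable_exponent hp hp1 hpt
  set G' : T → X → ℝ≥0∞ := fun t x => hG.mk _ (t, x) with hG'
  have hG'm : Measurable (Function.uncurry G') := hG.measurable_mk
  have e1 : lux μ p (fun x => ∫⁻ t, G t x ∂ν) = lux μ p' (fun x => ∫⁻ t, G' t x ∂ν) := by
    rw [lux_congr_exponent h4]
    refine lux_congr ?_
    have hswap : ∀ᵐ z ∂(μ.prod ν), G z.2 z.1 = G' z.2 z.1 :=
      (Measure.measurePreserving_swap (μ := μ) (ν := ν)).quasiMeasurePreserving.ae hG.ae_eq_mk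
    filter_upwards [Measure.ae_ae_of_ae_prod hswap] with x hx
    exact lintegral_congr_ae hx
  have e2 : ∫⁻ t, lux μ p (G t) ∂ν = ∫⁻ t, lux μ p' (G' t) ∂ν := by
    refine lintegral_congr_ae ?_
    filter_upwards [Measure.ae_ae_of_ae_prod hG.ae_eq_mk] with t ht
    rw [lux_congr_exponent h4]
    exact lux_congr ht
  rw [e1, e2]
  rcases eq_or_ne (∫⁻ t, lux μ p' (G' t) ∂ν) ∞ with htop | htop
  · rw [htop]; exact le_top
  -- a strictly positive function of small integral, added to the norms, makes the majorant strict
  refine ENNReal.le_of_forall_pos_le_add fun ε hε _ => ?_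
  obtain ⟨w, hw0, hwm, hw⟩ := exists_pos_lintegral_lt_of_sigmaFinite ν
    (ε := (ε : ℝ≥0∞)) (by simpa using hε.ne')
  have hm := measurable_lux (μ := μ) h1 h3 hG'm
  have hNint : ∫⁻ t, (lux μ p' (G' t) + w t) ∂ν = ∫⁻ t, lux μ p' (G' t) ∂ν + ∫⁻ t, (w t : ℝ≥0∞) ∂ν :=
    lintegral_add_left hm _
  refine (lux_lintegral_le_of_lt h1 h2 h3 hG'm (N := fun t => lux μ p' (G' t) + w t)
    (hm.add hwm.coe_nnreal_ennreal) ?_ ?_).trans ?_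
  · filter_upwards [ae_lt_top hm htop] with t ht
    exact ENNReal.lt_add_right ht.ne (by simpa using (hw0 t).ne')
  · rw [hNint]
    exact ENNReal.add_ne_top.2 ⟨htop, (hw.trans ENNReal.coe_lt_top).ne⟩
  · rw [hNint]
    gcongr

theorem aemeasurable_prod_of_countable [Countable X] [MeasurableSingletonClass X] [SFinite ν]
    [SFinite μ]
    (h : ∀ x, AEMeasurable (fun t => G t x) ν) : AEMeasurable (Function.uncurry G) (ν.prod μ) := by
  refine ⟨fun z => (h z.2).mk _ z.1, measurable_from_prod_countable_left fun x => (h x).measurable_mk, ?_⟩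
  have h1 : {z : T × X | Function.uncurry G z ≠ (h z.2).mk _ z.1} ⊆
      ⋃ x, {t | G t x ≠ (h x).mk _ t} ×ˢ {x} := by
    rintro ⟨t, x⟩ hz
    exact Set.mem_iUnion.2 ⟨x, hz, rfl⟩
  refine measure_mono_null h1 (measure_iUnion_null fun x => ?_)
  rw [Measure.prod_prod, show ν {t | G t x ≠ (h x).mk _ t} = 0 from (h x).ae_eq_mk, zero_mul]

theorem lux_sum_le [SFinite μ] {ι : Type*} (s : Finset ι) {g : ι → X → ℝ≥0∞}
    (hp : AEMeasurable p μ) (hp1 : ∀ x, 1 ≤ p x) (hpt : ∀ x, p x ≠ ∞)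
    (hg : ∀ i ∈ s, AEMeasurable (g i) μ) :
    lux μ p (fun x => ∑ i ∈ s, g i x) ≤ ∑ i ∈ s, lux μ p (g i) := by
  let _ : MeasurableSpace s := ⊤
  have hG : AEMeasurable (Function.uncurry fun (i : s) x => g i x)
      ((Measure.count : Measure s).prod μ) :=
    (aemeasurable_prod_of_countable (ν := μ) (μ := (Measure.count : Measure s))
      (G := fun x (i : s) => g i x) fun i => hg i i.2).prod_swap
  have h := lux_lintegral_le (ν := (Measure.count : Measure s)) hp hp1 hpt hG
  simp only [lintegral_count, tsum_fintype] at h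
  rw [Finset.sum_coe_sort s fun i => lux μ p (g i)] at h
  simpa only [fun x => Finset.sum_coe_sort s fun i => g i x] using h

end Minkowski

/-! ### Matrices -/

section Matrices

variable {n m : ℕ}

theorem matNorm_nonneg (A : Matrix (Fin n) (Fin n) ℝ) : 0 ≤ matNorm A := Real.sqrt_nonneg _

theorem norm_act_le (A : Matrix (Fin n) (Fin n) ℝ) (x : EuclideanSpace ℝ (Fin n)) :
    ‖act A x‖ ≤ matNorm A * ‖x‖ := by
  have h : ∑ j, ‖act A x j‖ ^ 2 ≤ (∑ j, ∑ k, A j k ^ 2) * ∑ k, ‖x k‖ ^ 2 := by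
    rw [Finset.sum_mul]
    refine Finset.sum_le_sum fun j _ => ?_
    simp only [Real.norm_eq_abs, sq_abs]
    exact Finset.sum_mul_sq_le_sq_mul_sq Finset.univ (fun k => A j k) (fun k => x k)
  rw [EuclideanSpace.norm_eq, EuclideanSpace.norm_eq x]
  exact (Real.sqrt_le_sqrt h).trans_eq
    (Real.sqrt_mul (Finset.sum_nonneg fun _ _ => Finset.sum_nonneg fun _ _ => sq_nonneg _) _)

theorem act_inv_act {A : Matrix (Fin n) (Fin n) ℝ} (hA : IsUnit A)
    (x : EuclideanSpace ℝ (Fin n)) : act A⁻¹ (act A x) = x := by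
  have h : IsUnit A.det := (Matrix.isUnit_iff_isUnit_det A).1 hA
  simp [act, Matrix.mulVec_mulVec, Matrix.nonsing_inv_mul A h]

theorem act_act_inv {A : Matrix (Fin n) (Fin n) ℝ} (hA : IsUnit A)
    (x : EuclideanSpace ℝ (Fin n)) : act A (act A⁻¹ x) = x := by
  have h : IsUnit A.det := (Matrix.isUnit_iff_isUnit_det A).1 hA
  simp [act, Matrix.mulVec_mulVec, Matrix.mul_nonsing_inv A h]

theorem one_le_matNorm_mul (hn : 0 < n) {A : Matrix (Fin n) (Fin n) ℝ} (hA : IsUnit A) :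
    1 ≤ matNorm A * matNorm A⁻¹ := by
  set e : EuclideanSpace ℝ (Fin n) := EuclideanSpace.single ⟨0, hn⟩ 1 with he
  have h1 : ‖e‖ = 1 := by simp [he]
  calc (1 : ℝ) = ‖act A (act A⁻¹ e)‖ := by rw [act_act_inv hA, h1]
    _ ≤ matNorm A * (matNorm A⁻¹ * ‖e‖) :=
      (norm_act_le _ _).trans (mul_le_mul_of_nonneg_left (norm_act_le _ _) (matNorm_nonneg _))
    _ = matNorm A * matNorm A⁻¹ := by rw [h1, mul_one]

theorem matNorm_pos (hn : 0 < n) {A : Matrix (Fin n) (Fin n) ℝ} (hA : IsUnit A) :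
    0 < matNorm A := by
  have h := one_le_matNorm_mul hn hA
  have h1 := matNorm_nonneg A
  by_contra h2
  have h3 : matNorm A = 0 := le_antisymm (not_lt.1 h2) h1
  rw [h3, zero_mul] at h
  linarith

theorem matNorm_inv_pos (hn : 0 < n) {A : Matrix (Fin n) (Fin n) ℝ} (hA : IsUnit A) :
    0 < matNorm A⁻¹ := by
  have h := one_le_matNorm_mul hn hA
  have h1 := matNorm_pos hn hA
  by_contra h2
  have h3 : matNorm A⁻¹ = 0 := le_antisymm (not_lt.1 h2) (matNorm_nonneg _)
  rw [h3, mul_zero] at h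
  linarith

/-- The supremum that defines `thetaStar` is attained. -/
theorem thetaStar_spec (hn : 0 < n) (hm : 0 < m) {A : Fin m → Matrix (Fin n) (Fin n) ℝ}
    (hA : ∀ i, IsUnit (A i)) :
    (∀ i, matNorm (A i) * matNorm (A i)⁻¹ < (2 : ℝ) ^ (-thetaStar A)) ∧ thetaStar A ≤ -1 := by
  set S := {k : ℤ | ∀ i, matNorm (A i) * matNorm (A i)⁻¹ < (2 : ℝ) ^ (-k)} with hS
  have hle : ∀ k ∈ S, k ≤ -1 := by
    intro k hk
    have h1 := (one_le_matNorm_mul hn (hA ⟨0, hm⟩)).trans_lt (hk ⟨0, hm⟩)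
    have h2 : 0 < -k := by
      by_contra h
      exact absurd h1 (not_lt.2 (zpow_le_one_of_nonpos₀ one_le_two (by omega)))
    omega
  have hne : S.Nonempty := by
    obtain ⟨N, hN⟩ := pow_unbounded_of_one_lt (∑ i, matNorm (A i) * matNorm (A i)⁻¹)
      (one_lt_two (α := ℝ))
    refine ⟨-N, fun i => ?_⟩
    rw [neg_neg, zpow_natCast]
    refine lt_of_le_of_lt ?_ hN
    exact Finset.single_le_sum (f := fun i => matNorm (A i) * matNorm (A i)⁻¹)
      (fun i _ => mul_nonneg (matNorm_nonneg _) (matNorm_nonneg _)) (Finset.mem_univ i)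
  have hmem : thetaStar A ∈ S := Int.csSup_mem hne ⟨-1, hle⟩
  exact ⟨hmem, hle _ hmem⟩

theorem continuous_act (A : Matrix (Fin n) (Fin n) ℝ) : Continuous (act A) :=
  (Matrix.toEuclideanLin A).continuous_of_finiteDimensional

theorem map_act_volume {A : Matrix (Fin n) (Fin n) ℝ} (hA : IsUnit A) :
    Measure.map (act A) volume = ENNReal.ofReal |A⁻¹.det| • volume := by
  have hdet : LinearMap.det (Matrix.toEuclideanLin A) = A.det := by
    rw [Matrix.toEuclideanLin_eq_toLin_orthonormal, LinearMap.det_toLin]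
  have h0 : A.det ≠ 0 := ((Matrix.isUnit_iff_isUnit_det A).1 hA).ne_zero
  have h := Measure.map_linearMap_addHaar_eq_smul_addHaar
    (μ := (volume : Measure (EuclideanSpace ℝ (Fin n)))) (f := Matrix.toEuclideanLin A)
    (by rwa [hdet])
  rw [hdet] at h
  rw [Matrix.det_nonsing_inv, Ring.inverse_eq_inv']
  exact h

theorem quasiMeasurePreserving_act {A : Matrix (Fin n) (Fin n) ℝ} (hA : IsUnit A) :
    Measure.QuasiMeasurePreserving (act A) volume volume := by
  refine ⟨(continuous_act A).measurable, ?_⟩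
  rw [map_act_volume hA]
  exact Measure.smul_absolutelyContinuous

theorem lintegral_comp_act {A : Matrix (Fin n) (Fin n) ℝ} (hA : IsUnit A)
    {h : EuclideanSpace ℝ (Fin n) → ℝ≥0∞} (hh : AEMeasurable h volume) :
    ∫⁻ x, h (act A x) = ENNReal.ofReal |A⁻¹.det| * ∫⁻ y, h y := by
  have h1 : AEMeasurable h (Measure.map (act A) volume) := by
    rw [map_act_volume hA]
    exact hh.smul_measure _
  rw [← lintegral_map' h1 (continuous_act A).measurable.aemeasurable, map_act_volume hA,
    lintegral_smul_measure, smul_eq_mul]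

end Matrices

/-! ### Composition with an invertible matrix -/

section Composition

variable {n : ℕ}

theorem varNorm_eq_lux (p : EuclideanSpace ℝ (Fin n) → ℝ≥0∞) (f : EuclideanSpace ℝ (Fin n) → ℂ) :
    varNorm p f = lux volume p (fun x => ‖f x‖ₑ) := by
  unfold varNorm lux
  refine iInf_congr fun η => iInf_congr fun hη => ?_
  have h (x) : ‖f x / (η : ℂ)‖ₑ = ‖f x‖ₑ / ENNReal.ofReal η := by
    have h1 : ‖(η : ℂ)‖ₑ = ENNReal.ofReal η := by
      rw [← ofReal_norm, Complex.norm_real, Real.norm_of_nonneg hη.le]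
    rw [div_eq_mul_inv, enorm_mul, enorm_inv (by simpa using hη.ne'), h1, div_eq_mul_inv]
  have h2 : modular p (fun x => f x / (η : ℂ)) =
      emodular volume p (fun x => ‖f x‖ₑ / ENNReal.ofReal η) := by
    simp only [modular, emodular, eLpNorm_exponent_top, eLpNormEssSup, h]
  rw [h2]

theorem IsBoundedExponent.ne_top {q : EuclideanSpace ℝ (Fin n) → ℝ≥0∞} (hq : IsBoundedExponent q)
    (x : EuclideanSpace ℝ (Fin n)) : q x ≠ ∞ :=
  ((hq.le_essSup x).trans_lt hq.essSup_lt_top).ne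

theorem IsBoundedExponent.ne_zero {q : EuclideanSpace ℝ (Fin n) → ℝ≥0∞} (hq : IsBoundedExponent q)
    (x : EuclideanSpace ℝ (Fin n)) : q x ≠ 0 :=
  (zero_lt_one.trans_le (hq.one_le x)).ne'

/-- The determinant factor of `cFactor` dominates the Jacobian: it is at least `δ^{1/s}` for every
`s` between the two bounds of the exponent. -/
theorem le_max_rpow {δ a b s : ℝ} (hδ : 0 ≤ δ) (ha : 0 < a) (has : a ≤ s) (hsb : s ≤ b) :
    δ ≤ max (δ ^ (1 / b)) (δ ^ (1 / a)) ^ s := by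
  have hs : 0 < s := ha.trans_le has
  have hb : 0 < b := hs.trans_le hsb
  rcases le_or_gt 1 δ with h | h
  · calc δ = δ ^ (1 : ℝ) := (Real.rpow_one _).symm
      _ ≤ δ ^ (1 / a * s) := Real.rpow_le_rpow_of_exponent_le h (by
          rw [one_div_mul_eq_div, le_div_iff₀ ha]; linarith)
      _ = (δ ^ (1 / a)) ^ s := Real.rpow_mul hδ _ _
      _ ≤ _ := Real.rpow_le_rpow (by positivity) (le_max_right _ _) hs.le
  · rcases hδ.eq_or_lt with h0 | h0
    · rw [← h0]; positivity
    calc δ = δ ^ (1 : ℝ) := (Real.rpow_one _).symm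
      _ ≤ δ ^ (1 / b * s) := Real.rpow_le_rpow_of_exponent_ge h0 h.le (by
          rw [one_div_mul_eq_div, div_le_one hb]; exact hsb)
      _ = (δ ^ (1 / b)) ^ s := Real.rpow_mul hδ _ _
      _ ≤ _ := Real.rpow_le_rpow (by positivity) (le_max_left _ _) hs.le

/-- The factor of `cFactor` that comes from the Jacobian. -/
noncomputable def detFactor (A : Matrix (Fin n) (Fin n) ℝ)
    (q : EuclideanSpace ℝ (Fin n) → ℝ≥0∞) : ℝ :=
  max (|A⁻¹.det| ^ (1 / (essSup q volume).toReal)) (|A⁻¹.det| ^ (1 / (essInf q volume).toReal))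

variable {A : Matrix (Fin n) (Fin n) ℝ} {q h : EuclideanSpace ℝ (Fin n) → ℝ≥0∞}

theorem detFactor_pos (hA : IsUnit A) : 0 < detFactor A q := by
  have h0 : A⁻¹.det ≠ 0 := (Matrix.isUnit_nonsing_inv_det A
    ((Matrix.isUnit_iff_isUnit_det A).1 hA)).ne_zero
  exact lt_max_of_lt_left (Real.rpow_pos_of_pos (abs_pos.2 h0) _)

theorem aemeasurable_comp_act_inv (hA : IsUnit A) (hq : AEMeasurable q volume) :
    AEMeasurable (fun x => q (act A⁻¹ x)) volume :=
  hq.comp_quasiMeasurePreserving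
    (quasiMeasurePreserving_act ((Matrix.isUnit_nonsing_inv_iff).2 hA))

theorem lux_comp_act_le_comp_exponent (hA : IsUnit A) (hq : IsBoundedExponent q)
    (hh : AEMeasurable h volume) :
    lux volume q (fun x => h (act A x)) ≤
      ENNReal.ofReal (detFactor A q) * lux volume (fun y => q (act A⁻¹ y)) h := by
  set D := ENNReal.ofReal (detFactor A q) with hD
  have hD0 : D ≠ 0 := by simpa [hD] using detFactor_pos hA
  have hDt : D ≠ ∞ := ENNReal.ofReal_ne_top
  rw [mul_comm, ← ENNReal.div_le_iff hD0 hDt]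
  refine le_of_forall_gt_imp_ge_of_dense fun d hd => ?_
  rw [ENNReal.div_le_iff hD0 hDt]
  refine lux_le_of_emodular_le (le_trans ?_ (emodular_div_le_of_lux_lt hd))
  rw [emodular_of_ne_top hq.ne_top, emodular_of_ne_top fun x => hq.ne_top _]
  set k : EuclideanSpace ℝ (Fin n) → ℝ≥0∞ :=
    fun y => (h y / (d * D)) ^ (q (act A⁻¹ y)).toReal with hk
  have hkm : AEMeasurable k volume :=
    (hh.div_const _).pow (aemeasurable_comp_act_inv hA hq.aemeasurable).ennreal_toReal
  calc ∫⁻ x, (h (act A x) / (d * D)) ^ (q x).toReal = ∫⁻ x, k (act A x) := by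
        refine lintegral_congr fun x => ?_
        rw [hk]
        simp only [act_inv_act hA]
    _ = ∫⁻ y, ENNReal.ofReal |A⁻¹.det| * k y := by
        rw [lintegral_comp_act hA hkm, lintegral_const_mul' _ _ ENNReal.ofReal_ne_top]
    _ ≤ ∫⁻ y, (h y / d) ^ (q (act A⁻¹ y)).toReal := by
        refine lintegral_mono fun y => ?_
        set s := (q (act A⁻¹ y)).toReal with hs
        have hspos : 0 ≤ s := ENNReal.toReal_nonneg
        have h1 : ENNReal.ofReal |A⁻¹.det| ≤ D ^ s := by
          rw [hD, ENNReal.ofReal_rpow_of_nonneg (detFactor_pos hA).le hspos]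
          refine ENNReal.ofReal_le_ofReal (le_max_rpow (abs_nonneg _) ?_ ?_ ?_)
          · exact ENNReal.toReal_pos (zero_lt_one.trans hq.one_lt_essInf).ne'
              ((hq.essInf_le y).trans_lt (hq.ne_top y).lt_top).ne
          · exact ENNReal.toReal_mono (hq.ne_top _) (hq.essInf_le _)
          · exact ENNReal.toReal_mono hq.essSup_lt_top.ne (hq.le_essSup _)
        have h2 : D ^ s ≠ 0 := by simp [hD0, hDt]
        have h3 : D ^ s ≠ ∞ := by simp [hD0, hDt]
        calc ENNReal.ofReal |A⁻¹.det| * k y ≤ D ^ s * k y := by gcongr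
          _ = D ^ s * ((h y / d) ^ s * (D ^ s)⁻¹) := by
            rw [hk]
            simp only [← hs]
            rw [div_eq_mul_inv, ENNReal.mul_inv (Or.inr hDt) (Or.inr hD0), ← mul_assoc,
              ENNReal.mul_rpow_of_nonneg _ _ hspos, ENNReal.inv_rpow, div_eq_mul_inv]
          _ = (h y / d) ^ s := by
            rw [mul_comm, mul_assoc, ENNReal.inv_mul_cancel h2 h3, mul_one]

theorem aemeasurable_theta {ζ : ℝ} (hA : IsUnit A) (hq : AEMeasurable q volume) :
    AEMeasurable (theta ζ q A) volume :=
  ((aemeasurable_comp_act_inv hA hq).inv.sub (hq.const_mul _).inv).inv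

theorem lux_comp_act_le {ζ : ℝ} (hA : IsUnit A) (hq : IsBoundedExponent q)
    (hh : AEMeasurable h volume) (hqζ : ∀ᵐ x, q (act A⁻¹ x) ≤ ENNReal.ofReal ζ * q x)
    (hϑ : lux volume (theta ζ q A) (fun _ => 1) ≠ ∞)
    (hfin : lux volume (fun x => ENNReal.ofReal ζ * q x) h ≠ ∞) :
    lux volume q (fun x => h (act A x)) ≤ ENNReal.ofReal (detFactor A q) *
      (2 * (lux volume (theta ζ q A) (fun _ => 1) *
        lux volume (fun x => ENNReal.ofReal ζ * q x) h)) := by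
  refine (lux_comp_act_le_comp_exponent hA hq hh).trans (mul_le_mul' le_rfl ?_)
  have key := lux_prod_le (μ := (volume : Measure (EuclideanSpace ℝ (Fin n)))) (ι := Fin 2)
    (s := fun y => q (act A⁻¹ y)) (e := ![theta ζ q A, fun x => ENNReal.ofReal ζ * q x])
    (g := ![fun _ => 1, h]) (fun x => hq.one_le _) (fun x => hq.ne_top _) ?_ ?_ ?_ ?_
  · simpa using key
  · filter_upwards [hqζ] with x hx
    simp only [Fin.sum_univ_two, Matrix.cons_val_zero, Matrix.cons_val_one, theta, inv_inv]
    rw [tsub_add_cancel_of_le (ENNReal.inv_le_inv.2 hx)]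
  · intro i
    fin_cases i
    · exact aemeasurable_theta hA hq.aemeasurable
    · exact hq.aemeasurable.const_mul _
  · intro i
    fin_cases i
    · exact aemeasurable_const
    · exact hh
  · intro i
    fin_cases i
    · exact hϑ
    · exact hfin

end Composition

/-! ### Dyadic annuli and log-Hölder weights -/

section Annuli

variable {n : ℕ}

theorem norm_pos_of_mem_annulus {k : ℤ} {x : EuclideanSpace ℝ (Fin n)} (hx : x ∈ annulus n k) :
    0 < ‖x‖ := lt_trans (by positivity) hx.1

theorem exists_mem_annulus {x : EuclideanSpace ℝ (Fin n)} (hx : x ≠ 0) : ∃ k, x ∈ annulus n k := by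
  obtain ⟨k, hk⟩ := exists_mem_Ioc_zpow (norm_pos_iff.2 hx) (one_lt_two (α := ℝ))
  exact ⟨k + 1, by simpa [annulus] using hk⟩

theorem le_of_mem_annulus {j k : ℤ} {x : EuclideanSpace ℝ (Fin n)} (hx : x ∈ annulus n j)
    (h : ‖x‖ ≤ (2 : ℝ) ^ k) : j ≤ k := by
  have h1 : (2 : ℝ) ^ (j - 1) < 2 ^ k := hx.1.trans_le h
  have := (zpow_lt_zpow_iff_right₀ (one_lt_two (α := ℝ))).1 h1
  omega

theorem measurableSet_annulus (k : ℤ) : MeasurableSet (annulus n k) :=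
  (measurableSet_lt measurable_const measurable_norm).inter
    (measurableSet_le measurable_norm measurable_const)

theorem mul_abs_le_of_abs_le_div {d C L κ : ℝ} (hL : 0 < L) (h : |d| ≤ C / L)
    (hκL : κ * (Real.log 2 / 2) ≤ L) : κ * |d| ≤ |C| * (2 / Real.log 2) := by
  have h2 : 0 < Real.log 2 := Real.log_pos one_lt_two
  rw [le_div_iff₀ hL] at h
  have h3 : |d| * (κ * (Real.log 2 / 2)) ≤ |C| :=
    (mul_le_mul_of_nonneg_left hκL (abs_nonneg _)).trans (h.trans (le_abs_self C))
  calc κ * |d| = (|d| * (κ * (Real.log 2 / 2))) * (2 / Real.log 2) := by field_simp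
    _ ≤ _ := mul_le_mul_of_nonneg_right h3 (by positivity)

/-- Log-Hölder continuity at the origin and at infinity, with the same value, makes `2 ^ (k α(x))`
comparable to `2 ^ (k α(0))` on the annulus `C_k`, uniformly in `k`. -/
theorem exists_abs_mul_sub_le {α : EuclideanSpace ℝ (Fin n) → ℝ} {αInf : ℝ}
    (h0 : LogHolderAtZero α) (hInf : LogHolderAtInfinity α αInf) (heq : α 0 = αInf) :
    ∃ C : ℝ, 0 ≤ C ∧ ∀ (k : ℤ), ∀ x ∈ annulus n k, |(k : ℝ) * (α x - α 0)| ≤ C := by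
  obtain ⟨C₀, hC₀⟩ := h0
  obtain ⟨C₁, hC₁⟩ := hInf
  have h2 : 0 < Real.log 2 := Real.log_pos one_lt_two
  have he : 0 < Real.exp 1 := Real.exp_pos 1
  refine ⟨(|C₀| + |C₁|) * (2 / Real.log 2), by positivity, fun k x hx => ?_⟩
  have hx0 := norm_pos_of_mem_annulus hx
  rw [abs_mul]
  rcases le_or_gt k 0 with hk | hk
  · have h3 : |(k : ℝ)| = ((-k : ℤ) : ℝ) := by
      rw [abs_of_nonpos (by exact_mod_cast hk)]; push_cast; ring
    have h4 : |(k : ℝ)| * Real.log 2 ≤ Real.log (Real.exp 1 + 1 / ‖x‖) := by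
      rw [h3, ← Real.log_zpow]
      refine Real.log_le_log (by positivity) ?_
      have : (2 : ℝ) ^ (-k) ≤ 1 / ‖x‖ := by
        rw [zpow_neg, ← one_div]
        exact one_div_le_one_div_of_le hx0 hx.2
      linarith
    have h5 : 0 < Real.log (Real.exp 1 + 1 / ‖x‖) := by
      refine Real.log_pos ?_
      have := Real.add_one_le_exp (1 : ℝ)
      have : 0 < 1 / ‖x‖ := by positivity
      linarith
    refine (mul_abs_le_of_abs_le_div h5 (hC₀ x) ?_).trans ?_
    · nlinarith [abs_nonneg (k : ℝ)]
    · exact mul_le_mul_of_nonneg_right (by linarith [abs_nonneg C₁]) (by positivity)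
  · have h3 : |(k : ℝ)| = ((k - 1 : ℤ) : ℝ) + 1 := by
      rw [abs_of_nonneg (by exact_mod_cast hk.le)]; push_cast; ring
    have h4 : ((k - 1 : ℤ) : ℝ) * Real.log 2 ≤ Real.log (Real.exp 1 + ‖x‖) := by
      rw [← Real.log_zpow]
      exact Real.log_le_log (by positivity) (by linarith [hx.1])
    have h5 : 1 ≤ Real.log (Real.exp 1 + ‖x‖) := by
      rw [Real.le_log_iff_exp_le (by positivity)]
      linarith
    have h6 : Real.log 2 ≤ 1 := by
      have := Real.log_two_lt_d9; linarith
    rw [heq]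
    refine (mul_abs_le_of_abs_le_div (by linarith) (hC₁ x) ?_).trans ?_
    · rw [h3]; linarith
    · exact mul_le_mul_of_nonneg_right (by linarith [abs_nonneg C₀]) (by positivity)

/-- The function `2 ^ (k α) w F` on the annulus `C_k`, whose norm enters the Herz norm. -/
noncomputable def piece (α w : EuclideanSpace ℝ (Fin n) → ℝ) (F : EuclideanSpace ℝ (Fin n) → ℝ≥0∞)
    (k : ℤ) : EuclideanSpace ℝ (Fin n) → ℝ≥0∞ :=
  (annulus n k).indicator fun x => ENNReal.ofReal ((2 : ℝ) ^ ((k : ℝ) * α x) * w x) * F x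

theorem aemeasurable_piece {α w : EuclideanSpace ℝ (Fin n) → ℝ}
    {F : EuclideanSpace ℝ (Fin n) → ℝ≥0∞} (hα : AEMeasurable α volume) (hw : AEMeasurable w volume)
    (hF : AEMeasurable F volume) (k : ℤ) : AEMeasurable (piece α w F k) volume :=
  (((aemeasurable_const.pow (hα.const_mul _)).mul hw).ennreal_ofReal.mul hF).indicator
    (measurableSet_annulus k)

theorem wNorm_eq_lux {α w : EuclideanSpace ℝ (Fin n) → ℝ} (hw : ∀ x, 0 ≤ w x)
    (q : EuclideanSpace ℝ (Fin n) → ℝ≥0∞) (f : EuclideanSpace ℝ (Fin n) → ℂ) (k : ℤ) :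
    wNorm q w ((annulus n k).indicator fun x => (((2 : ℝ) ^ ((k : ℝ) * α x) : ℝ) : ℂ) * f x) =
      lux volume q (piece α w (fun x => ‖f x‖ₑ) k) := by
  rw [wNorm, varNorm_eq_lux]
  congr 1
  ext x
  by_cases hx : x ∈ annulus n k
  · simp only [piece, Set.indicator_of_mem hx]
    have h2 : 0 ≤ (2 : ℝ) ^ ((k : ℝ) * α x) := by positivity
    rw [enorm_mul, enorm_mul, ENNReal.ofReal_mul h2, ← ofReal_norm ((w x : ℝ) : ℂ),
      ← ofReal_norm ((((2 : ℝ) ^ ((k : ℝ) * α x) : ℝ)) : ℂ), Complex.norm_real, Complex.norm_real,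
      Real.norm_of_nonneg h2, Real.norm_of_nonneg (hw x)]
    ring
  · simp [piece, hx]

theorem herzNorm_eq_lux {α w : EuclideanSpace ℝ (Fin n) → ℝ} (hw : ∀ x, 0 ≤ w x) {p : ℝ}
    (hp : 0 < p) (q : EuclideanSpace ℝ (Fin n) → ℝ≥0∞) (f : EuclideanSpace ℝ (Fin n) → ℂ) :
    herzNorm α p q w f = lux Measure.count (fun _ => ENNReal.ofReal p)
      (fun k : ℤ => lux volume q (piece α w (fun x => ‖f x‖ₑ) k)) := by
  rw [lux_const hp, lintegral_count]
  simp only [herzNorm, wNorm_eq_lux hw]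

theorem le_lux_count {p : ℝ} (hp : 0 < p) (a : ℤ → ℝ≥0∞) (k : ℤ) :
    a k ≤ lux Measure.count (fun _ => ENNReal.ofReal p) a := by
  rw [lux_const hp, lintegral_count, one_div, ENNReal.le_rpow_inv_iff hp]
  exact ENNReal.le_tsum (f := fun k => a k ^ p) k

theorem lux_count_shift {p : ℝ} (hp : 0 < p) (a : ℤ → ℝ≥0∞) (l : ℤ) :
    lux Measure.count (fun _ => ENNReal.ofReal p) (fun k => a (k + l)) =
      lux Measure.count (fun _ => ENNReal.ofReal p) a := by
  simp only [lux_const hp, lintegral_count]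
  exact congrArg (· ^ (1 / p)) ((Equiv.addRight l).tsum_eq fun k => a k ^ p)

variable {A : Matrix (Fin n) (Fin n) ℝ}

/-- If `2 ^ (l - 1) < ‖A‖ ≤ 2 ^ l`, then `A` maps `C_k` into the union of the annuli `C_{k+l+ρ}`
with `Θ - 1 ≤ ρ ≤ 0`. -/
theorem exists_act_mem_annulus (hn : 0 < n) (hA : IsUnit A) {Θ l k : ℤ}
    (hΘ : matNorm A * matNorm A⁻¹ < (2 : ℝ) ^ (-Θ)) (hl1 : (2 : ℝ) ^ (l - 1) < matNorm A)
    (hl2 : matNorm A ≤ (2 : ℝ) ^ l) {x : EuclideanSpace ℝ (Fin n)} (hx : x ∈ annulus n k) :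
    ∃ ρ ∈ Finset.Icc (Θ - 1) 0, act A x ∈ annulus n (k + l + ρ) := by
  have hx0 := norm_pos_of_mem_annulus hx
  have hxle : ‖x‖ ≤ matNorm A⁻¹ * ‖act A x‖ := by
    have := norm_act_le A⁻¹ (act A x)
    rwa [act_inv_act hA] at this
  have hAx : act A x ≠ 0 := by
    intro h
    rw [h, norm_zero, mul_zero] at hxle
    linarith
  obtain ⟨j, hj⟩ := exists_mem_annulus hAx
  have hup : j ≤ k + l := by
    refine le_of_mem_annulus hj ?_
    rw [add_comm, zpow_add₀ two_ne_zero]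
    exact (norm_act_le A x).trans (mul_le_mul hl2 hx.2 hx0.le (by positivity))
  have hlow : (2 : ℝ) ^ (l - 1 + (k - 1)) < 2 ^ (-Θ + j) := by
    rw [zpow_add₀ two_ne_zero, zpow_add₀ two_ne_zero]
    have hApos := matNorm_pos hn hA
    have hA'pos := matNorm_inv_pos hn hA
    calc (2 : ℝ) ^ (l - 1) * 2 ^ (k - 1) < matNorm A * ‖x‖ :=
          mul_lt_mul'' hl1 hx.1 (by positivity) (by positivity)
      _ ≤ matNorm A * (matNorm A⁻¹ * ‖act A x‖) := mul_le_mul_of_nonneg_left hxle hApos.le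
      _ = matNorm A * matNorm A⁻¹ * ‖act A x‖ := by ring
      _ ≤ 2 ^ (-Θ) * 2 ^ j := mul_le_mul hΘ.le hj.2 (norm_nonneg _) (by positivity)
  have hlow' := (zpow_lt_zpow_iff_right₀ (one_lt_two (α := ℝ))).1 hlow
  refine ⟨j - k - l, Finset.mem_Icc.2 ⟨by omega, by omega⟩, ?_⟩
  rwa [show k + l + (j - k - l) = j by ring]

theorem norm_rpow_le (hn : 0 < n) (hA : IsUnit A) {x : EuclideanSpace ℝ (Fin n)} (hx : x ≠ 0)
    (γ : ℝ) :
    ‖x‖ ^ γ ≤ max (matNorm A ^ (-γ)) (matNorm A⁻¹ ^ γ) * ‖act A x‖ ^ γ := by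
  have hx0 := norm_pos_iff.2 hx
  have hApos := matNorm_pos hn hA
  have hA'pos := matNorm_inv_pos hn hA
  have hxle : ‖x‖ ≤ matNorm A⁻¹ * ‖act A x‖ := by
    have := norm_act_le A⁻¹ (act A x)
    rwa [act_inv_act hA] at this
  have hle := norm_act_le A x
  rcases le_or_gt 0 γ with h | h
  · calc ‖x‖ ^ γ ≤ (matNorm A⁻¹ * ‖act A x‖) ^ γ := Real.rpow_le_rpow hx0.le hxle h
      _ = matNorm A⁻¹ ^ γ * ‖act A x‖ ^ γ := Real.mul_rpow hA'pos.le (norm_nonneg _)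
      _ ≤ _ := mul_le_mul_of_nonneg_right (le_max_right _ _) (by positivity)
  · have hpos : 0 < ‖act A x‖ := by
      rcases (norm_nonneg (act A x)).eq_or_lt with h0 | h0
      · rw [← h0, mul_zero] at hxle; linarith
      · exact h0
    calc ‖x‖ ^ γ = matNorm A ^ (-γ) * (matNorm A * ‖x‖) ^ γ := by
          rw [Real.mul_rpow hApos.le hx0.le, ← mul_assoc, ← Real.rpow_add hApos]; simp
      _ ≤ matNorm A ^ (-γ) * ‖act A x‖ ^ γ :=
          mul_le_mul_of_nonneg_left (Real.rpow_le_rpow_of_nonpos hpos hle h.le) (by positivity)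
      _ ≤ _ := mul_le_mul_of_nonneg_right (le_max_left _ _) (by positivity)

/-- Transport of the weight of `C_k` to that of the annulus that contains `A x`. -/
theorem weight_le_weight_act (hn : 0 < n) (hA : IsUnit A) {l k ρ : ℤ}
    (hl1 : (2 : ℝ) ^ (l - 1) < matNorm A) (hl2 : matNorm A ≤ (2 : ℝ) ^ l)
    {α : EuclideanSpace ℝ (Fin n) → ℝ} {C : ℝ}
    (hC : ∀ (k : ℤ), ∀ x ∈ annulus n k, |(k : ℝ) * (α x - α 0)| ≤ C) (γ : ℝ)
    {x : EuclideanSpace ℝ (Fin n)} (hx : x ∈ annulus n k)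
    (hAx : act A x ∈ annulus n (k + l + ρ)) :
    (2 : ℝ) ^ ((k : ℝ) * α x) * ‖x‖ ^ γ ≤
      2 ^ (2 * C + |α 0|) * max (matNorm A ^ (-γ)) (matNorm A⁻¹ ^ γ) *
        matNorm A ^ (0 - α 0) * 2 ^ ((ρ : ℝ) * (0 - α 0)) *
        (2 ^ (((k + l + ρ : ℤ) : ℝ) * α (act A x)) * ‖act A x‖ ^ γ) := by
  have hApos := matNorm_pos hn hA
  have h1 := abs_le.1 (hC k x hx)
  have h2 := abs_le.1 (hC _ _ hAx)
  -- `‖A‖ = 2 ^ ℓ` with `l - 1 < ℓ ≤ l`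
  set ℓ := Real.logb 2 (matNorm A) with hlam
  have hA2 : matNorm A = 2 ^ ℓ := (Real.rpow_logb two_pos (by norm_num) hApos).symm
  have hlam1 : (l : ℝ) - 1 < ℓ := by
    rw [hA2, ← Real.rpow_intCast] at hl1
    have := (Real.rpow_lt_rpow_left_iff (one_lt_two (α := ℝ))).1 hl1
    push_cast at this
    exact this
  have hlam2 : ℓ ≤ l := by
    rw [hA2, ← Real.rpow_intCast] at hl2
    exact (Real.rpow_le_rpow_left_iff (one_lt_two (α := ℝ))).1 hl2
  have hexp : (2 : ℝ) ^ ((k : ℝ) * α x) ≤ 2 ^ (2 * C + |α 0|) * matNorm A ^ (0 - α 0) *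
      2 ^ ((ρ : ℝ) * (0 - α 0)) * 2 ^ (((k + l + ρ : ℤ) : ℝ) * α (act A x)) := by
    rw [hA2, ← Real.rpow_mul two_pos.le, ← Real.rpow_add two_pos, ← Real.rpow_add two_pos,
      ← Real.rpow_add two_pos]
    refine Real.rpow_le_rpow_of_exponent_le one_le_two ?_
    push_cast at h2 ⊢
    have h3 : -|α 0| ≤ (l - ℓ) * α 0 := by
      have : |(l - ℓ) * α 0| ≤ 1 * |α 0| := by
        rw [abs_mul]
        exact mul_le_mul_of_nonneg_right (abs_le.2 ⟨by linarith, by linarith⟩) (abs_nonneg _)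
      linarith [(abs_le.1 this).1]
    nlinarith [h1.2, h2.1]
  have hx0 : x ≠ 0 := norm_pos_iff.1 (norm_pos_of_mem_annulus hx)
  calc (2 : ℝ) ^ ((k : ℝ) * α x) * ‖x‖ ^ γ ≤ _ :=
      mul_le_mul hexp (norm_rpow_le hn hA hx0 γ) (by positivity) (by positivity)
    _ = _ := by ring

theorem piece_comp_act_le (hn : 0 < n) (hA : IsUnit A) {Θ l k : ℤ}
    (hΘ : matNorm A * matNorm A⁻¹ < (2 : ℝ) ^ (-Θ)) (hl1 : (2 : ℝ) ^ (l - 1) < matNorm A)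
    (hl2 : matNorm A ≤ (2 : ℝ) ^ l) {α : EuclideanSpace ℝ (Fin n) → ℝ} {C : ℝ}
    (hC : ∀ (k : ℤ), ∀ x ∈ annulus n k, |(k : ℝ) * (α x - α 0)| ≤ C) (γ : ℝ)
    (F : EuclideanSpace ℝ (Fin n) → ℝ≥0∞) (x : EuclideanSpace ℝ (Fin n)) :
    piece α (fun x => ‖x‖ ^ γ) (fun x => F (act A x)) k x ≤
      ENNReal.ofReal (2 ^ (2 * C + |α 0|) * max (matNorm A ^ (-γ)) (matNorm A⁻¹ ^ γ) *
        matNorm A ^ (0 - α 0)) * ∑ ρ ∈ Finset.Icc (Θ - 1) 0,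
          ENNReal.ofReal (2 ^ ((ρ : ℝ) * (0 - α 0))) *
            piece α (fun x => ‖x‖ ^ γ) F (k + l + ρ) (act A x) := by
  by_cases hx : x ∈ annulus n k
  · obtain ⟨ρ, hρ, hAx⟩ := exists_act_mem_annulus hn hA hΘ hl1 hl2 hx
    refine le_trans ?_ (mul_le_mul' le_rfl (Finset.single_le_sum
      (f := fun ρ : ℤ => ENNReal.ofReal (2 ^ ((ρ : ℝ) * (0 - α 0))) *
        piece α (fun x => ‖x‖ ^ γ) F (k + l + ρ) (act A x)) (fun _ _ => zero_le) hρ))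
    simp only [piece, Set.indicator_of_mem hx, Set.indicator_of_mem hAx]
    have hA0 := matNorm_nonneg A
    rw [← mul_assoc, ← mul_assoc, ← ENNReal.ofReal_mul (by positivity),
      ← ENNReal.ofReal_mul (by positivity)]
    exact mul_le_mul' (ENNReal.ofReal_le_ofReal
      (weight_le_weight_act hn hA hl1 hl2 hC γ hx hAx)) le_rfl
  · simp [piece, hx]

end Annuli

/-! ### The Herz norm of a composition -/

section HerzComposition

variable {n : ℕ} {A : Matrix (Fin n) (Fin n) ℝ} {α : EuclideanSpace ℝ (Fin n) → ℝ}
  {q F : EuclideanSpace ℝ (Fin n) → ℝ≥0∞} {ζ γ C : ℝ}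

theorem aemeasurable_norm_rpow (γ : ℝ) :
    AEMeasurable (fun x : EuclideanSpace ℝ (Fin n) => ‖x‖ ^ γ) volume :=
  (measurable_norm.pow_const γ).aemeasurable

theorem lux_piece_comp_act_le (hn : 0 < n) (hA : IsUnit A) {Θ l k : ℤ}
    (hΘ : matNorm A * matNorm A⁻¹ < (2 : ℝ) ^ (-Θ)) (hl1 : (2 : ℝ) ^ (l - 1) < matNorm A)
    (hl2 : matNorm A ≤ (2 : ℝ) ^ l) (hα : AEMeasurable α volume)
    (hC : ∀ (k : ℤ), ∀ x ∈ annulus n k, |(k : ℝ) * (α x - α 0)| ≤ C)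
    (hq : IsBoundedExponent q) (hqζ : ∀ᵐ x, q (act A⁻¹ x) ≤ ENNReal.ofReal ζ * q x)
    (hϑ : lux volume (theta ζ q A) (fun _ => 1) ≠ ∞) (hF : AEMeasurable F volume)
    (hfin : ∀ j, lux volume (fun x => ENNReal.ofReal ζ * q x)
      (piece α (fun x => ‖x‖ ^ γ) F j) ≠ ∞) :
    lux volume q (piece α (fun x => ‖x‖ ^ γ) (fun x => F (act A x)) k) ≤
      ENNReal.ofReal (2 ^ (2 * C + |α 0|) * max (matNorm A ^ (-γ)) (matNorm A⁻¹ ^ γ) *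
        matNorm A ^ (0 - α 0)) * ∑ ρ ∈ Finset.Icc (Θ - 1) 0,
          ENNReal.ofReal (2 ^ ((ρ : ℝ) * (0 - α 0))) * (ENNReal.ofReal (detFactor A q) *
            (2 * (lux volume (theta ζ q A) (fun _ => 1) *
              lux volume (fun x => ENNReal.ofReal ζ * q x)
                (piece α (fun x => ‖x‖ ^ γ) F (k + l + ρ))))) := by
  have hm (j : ℤ) := aemeasurable_piece hα (aemeasurable_norm_rpow γ) hF j
  refine (lux_mono (ae_of_all _ fun x =>
    piece_comp_act_le hn hA hΘ hl1 hl2 hC γ F x)).trans ?_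
  refine (lux_const_mul_le hq.ne_zero hq.ne_top ENNReal.ofReal_ne_top).trans
    (mul_le_mul' le_rfl ?_)
  refine (lux_sum_le _ hq.aemeasurable hq.one_le hq.ne_top fun ρ _ =>
    ((hm _).comp_quasiMeasurePreserving (quasiMeasurePreserving_act hA)).const_mul _).trans
    (Finset.sum_le_sum fun ρ _ => ?_)
  refine (lux_const_mul_le hq.ne_zero hq.ne_top ENNReal.ofReal_ne_top).trans
    (mul_le_mul' le_rfl ?_)
  exact lux_comp_act_le hA hq (hm _) hqζ hϑ (hfin _)

theorem cFactor_eq (A : Matrix (Fin n) (Fin n) ℝ) (q : EuclideanSpace ℝ (Fin n) → ℝ≥0∞) (γ : ℝ) :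
    cFactor A q γ = max (matNorm A ^ (-γ)) (matNorm A⁻¹ ^ γ) * detFactor A q := rfl

theorem phiFactor_eq (A : Matrix (Fin n) (Fin n) ℝ) (Θ : ℤ) (a : ℝ) :
    phiFactor A Θ 0 a a =
      matNorm A ^ (0 - a) * ∑ ρ ∈ Finset.Icc (Θ - 1) 0, (2 : ℝ) ^ ((ρ : ℝ) * (0 - a)) := by
  simp [phiFactor]

theorem lux_count_piece_comp_act_le (hn : 0 < n) (hA : IsUnit A) {Θ : ℤ}
    (hΘ : matNorm A * matNorm A⁻¹ < (2 : ℝ) ^ (-Θ)) (hα : AEMeasurable α volume)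
    (hC : ∀ (k : ℤ), ∀ x ∈ annulus n k, |(k : ℝ) * (α x - α 0)| ≤ C)
    (hq : IsBoundedExponent q) (hqζ : ∀ᵐ x, q (act A⁻¹ x) ≤ ENNReal.ofReal ζ * q x)
    (hϑ : lux volume (theta ζ q A) (fun _ => 1) ≠ ∞) (hF : AEMeasurable F volume)
    {P : ℝ} (hP : 1 ≤ P)
    (hfin : lux Measure.count (fun _ => ENNReal.ofReal P) (fun k : ℤ =>
      lux volume (fun x => ENNReal.ofReal ζ * q x) (piece α (fun x => ‖x‖ ^ γ) F k)) ≠ ∞) :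
    lux Measure.count (fun _ => ENNReal.ofReal P) (fun k : ℤ =>
      lux volume q (piece α (fun x => ‖x‖ ^ γ) (fun x => F (act A x)) k)) ≤
    ENNReal.ofReal (2 * 2 ^ (2 * C + |α 0|)) *
      (ENNReal.ofReal (cFactor A q γ) * lux volume (theta ζ q A) (fun _ => 1) *
        ENNReal.ofReal (phiFactor A Θ 0 (α 0) (α 0))) *
      lux Measure.count (fun _ => ENNReal.ofReal P) (fun k : ℤ =>
        lux volume (fun x => ENNReal.ofReal ζ * q x) (piece α (fun x => ‖x‖ ^ γ) F k)) := by
  have hP0 : 0 < P := by linarith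
  have hApos := matNorm_pos hn hA
  obtain ⟨l, hl⟩ := exists_mem_Ioc_zpow hApos (one_lt_two (α := ℝ))
  have hl1 : (2 : ℝ) ^ ((l + 1) - 1) < matNorm A := by simpa using hl.1
  set a : ℤ → ℝ≥0∞ := fun k => lux volume (fun x => ENNReal.ofReal ζ * q x)
    (piece α (fun x => ‖x‖ ^ γ) F k) with ha
  have hfin' (j) : a j ≠ ∞ := ne_top_of_le_ne_top hfin (le_lux_count hP0 a j)
  have h1 (x : ℤ) : 1 ≤ ENNReal.ofReal P := by simpa using hP
  have h0 (x : ℤ) : ENNReal.ofReal P ≠ 0 := by simpa using hP0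
  have ht (x : ℤ) : ENNReal.ofReal P ≠ ∞ := ENNReal.ofReal_ne_top
  set N := lux volume (theta ζ q A) (fun _ => 1) with hN
  refine (lux_mono (ae_of_all _ fun k =>
    lux_piece_comp_act_le hn hA hΘ hl1 hl.2 hα hC hq hqζ hϑ hF hfin')).trans ?_
  refine (lux_const_mul_le h0 ht ENNReal.ofReal_ne_top).trans ?_
  have hsum : lux Measure.count (fun _ => ENNReal.ofReal P) (fun k : ℤ =>
      ∑ ρ ∈ Finset.Icc (Θ - 1) 0, ENNReal.ofReal (2 ^ ((ρ : ℝ) * (0 - α 0))) *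
        (ENNReal.ofReal (detFactor A q) * (2 * (N * a (k + (l + 1) + ρ))))) ≤
      ∑ ρ ∈ Finset.Icc (Θ - 1) 0, ENNReal.ofReal (2 ^ ((ρ : ℝ) * (0 - α 0))) *
        (ENNReal.ofReal (detFactor A q) *
          (2 * (N * lux Measure.count (fun _ => ENNReal.ofReal P) a))) := by
    refine (lux_sum_le _ aemeasurable_const h1 ht
      fun ρ _ => (measurable_of_countable _).aemeasurable).trans (Finset.sum_le_sum fun ρ _ => ?_)
    refine (lux_const_mul_le h0 ht ENNReal.ofReal_ne_top).trans (mul_le_mul' le_rfl ?_)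
    refine (lux_const_mul_le h0 ht ENNReal.ofReal_ne_top).trans (mul_le_mul' le_rfl ?_)
    refine (lux_const_mul_le h0 ht ENNReal.ofNat_ne_top).trans (mul_le_mul' le_rfl ?_)
    refine (lux_const_mul_le h0 ht hϑ).trans (mul_le_mul' le_rfl ?_)
    simp only [add_assoc]
    exact (lux_count_shift hP0 a _).le
  refine (mul_le_mul' le_rfl hsum).trans (le_of_eq ?_)
  have hpos1 : 0 ≤ matNorm A ^ (0 - α 0) := by positivity
  have hmax : 0 ≤ max (matNorm A ^ (-γ)) (matNorm A⁻¹ ^ γ) :=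
    le_max_of_le_left (by positivity)
  rw [← Finset.sum_mul, cFactor_eq, phiFactor_eq, ENNReal.ofReal_mul (by positivity),
    ENNReal.ofReal_mul (by positivity), ENNReal.ofReal_mul two_pos.le, ENNReal.ofReal_mul hmax,
    ENNReal.ofReal_mul hpos1, ENNReal.ofReal_sum_of_nonneg (fun _ _ => by positivity),
    ENNReal.ofReal_ofNat]
  ring

end HerzComposition

/-! ### Norms on the annuli with the exponents `r` -/

section RemainderFactor

variable {n : ℕ}

/-- The part `2 ^ (-k (γ + n) / r) |x| ^ (γ / r)` of the target weight on `C_k` that is paired with the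
exponent `r` in Hölder's inequality; it equals `1` where `r = ∞`. -/
noncomputable def rPiece (γ : ℝ) (r : EuclideanSpace ℝ (Fin n) → ℝ≥0∞) (k : ℤ) :
    EuclideanSpace ℝ (Fin n) → ℝ≥0∞ :=
  (annulus n k).indicator fun x =>
    ENNReal.ofReal ((2 : ℝ) ^ (-((k : ℝ) * ((γ + n) * ((r x)⁻¹).toReal))) *
      ‖x‖ ^ (γ * ((r x)⁻¹).toReal))

theorem aemeasurable_rPiece {γ : ℝ} {r : EuclideanSpace ℝ (Fin n) → ℝ≥0∞}
    (hr : AEMeasurable r volume) (k : ℤ) : AEMeasurable (rPiece γ r k) volume := by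
  have h1 : AEMeasurable (fun x => ((r x)⁻¹).toReal) volume := hr.inv.ennreal_toReal
  exact ((aemeasurable_const.pow ((h1.const_mul _).const_mul _).neg).mul
    (measurable_norm.aemeasurable.pow (h1.const_mul _))).ennreal_ofReal.indicator
    (measurableSet_annulus k)

theorem volume_annulus_le (k : ℤ) : volume (annulus n k) ≤
    ENNReal.ofReal (((2 : ℝ) ^ k) ^ n) *
      volume (Metric.closedBall (0 : EuclideanSpace ℝ (Fin n)) 1) := by
  have h := Measure.addHaar_closedBall_mul
    (volume : Measure (EuclideanSpace ℝ (Fin n))) 0 (r := (2 : ℝ) ^ k) (by positivity)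
    (s := 1) zero_le_one
  rw [mul_one, finrank_euclideanSpace, Fintype.card_fin] at h
  rw [← h]
  exact measure_mono fun x hx => by simpa using hx.2

theorem norm_rpow_le_of_mem_annulus {k : ℤ} {x : EuclideanSpace ℝ (Fin n)} (hx : x ∈ annulus n k)
    (γ : ℝ) : ‖x‖ ^ γ ≤ 2 ^ |γ| * ((2 : ℝ) ^ k) ^ γ := by
  have hx0 := norm_pos_of_mem_annulus hx
  have h2k : (0 : ℝ) < 2 ^ k := by positivity
  rcases le_or_gt 0 γ with h | h
  · calc ‖x‖ ^ γ ≤ 1 * ((2 : ℝ) ^ k) ^ γ := by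
          rw [one_mul]; exact Real.rpow_le_rpow hx0.le hx.2 h
      _ ≤ _ := mul_le_mul_of_nonneg_right (Real.one_le_rpow one_le_two (abs_nonneg _))
          (by positivity)
  · have h1 : (2 : ℝ) ^ (k - 1) = 2⁻¹ * 2 ^ k := by
      rw [zpow_sub_one₀ two_ne_zero]; ring
    calc ‖x‖ ^ γ ≤ (2⁻¹ * (2 : ℝ) ^ k) ^ γ :=
          Real.rpow_le_rpow_of_nonpos (by positivity) (h1 ▸ hx.1.le) h.le
      _ = _ := by
          rw [Real.mul_rpow (by positivity) h2k.le, Real.inv_rpow two_pos.le,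
            ← Real.rpow_neg two_pos.le, abs_of_neg h]

/-- The modular of `rPiece` over `{r < ∞}` is the integral of `2 ^ (-k (γ + n)) |x| ^ γ` over part
of `C_k`, which does not exceed a constant independent of `k`. -/
theorem exists_lux_rPiece_le (γ : ℝ) {r : EuclideanSpace ℝ (Fin n) → ℝ≥0∞} (hr : IsExponent r) :
    ∃ c : ℝ≥0, ∀ k, lux volume r (rPiece γ r k) ≤ c := by
  set V := ENNReal.ofReal (2 ^ |γ|) *
    volume (Metric.closedBall (0 : EuclideanSpace ℝ (Fin n)) 1) with hV
  have hVt : V ≠ ∞ := ENNReal.mul_ne_top ENNReal.ofReal_ne_top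
    (isCompact_closedBall _ _).measure_ne_top
  refine ⟨(V + 1).toNNReal, fun k => ?_⟩
  have hct : V + 1 ≠ ∞ := by simp [hVt]
  have hc1 : 1 ≤ V + 1 := le_add_self
  have hc0 : V + 1 ≠ 0 := (zero_lt_one.trans_le hc1).ne'
  rw [ENNReal.coe_toNNReal hct]
  refine lux_le_of_emodular_le ?_
  have hbound (x : EuclideanSpace ℝ (Fin n)) (hx : r x ≠ ∞) :
      (rPiece γ r k x / (V + 1)) ^ (r x).toReal ≤ (annulus n k).indicator
        (fun _ => (V + 1)⁻¹ * ENNReal.ofReal (2 ^ |γ| * (((2 : ℝ) ^ k) ^ n)⁻¹)) x := by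
    have hr1 : 1 ≤ (r x).toReal := by simpa using ENNReal.toReal_mono hx (hr.one_le x)
    have hr0 : 0 < (r x).toReal := by linarith
    by_cases hxk : x ∈ annulus n k
    · have hx0 := norm_pos_of_mem_annulus hxk
      have h2k : (0 : ℝ) < 2 ^ k := by positivity
      simp only [rPiece, Set.indicator_of_mem hxk]
      rw [div_eq_mul_inv, mul_comm, ENNReal.mul_rpow_of_nonneg _ _ hr0.le]
      refine mul_le_mul' (ENNReal.rpow_le_self_of_le_one (ENNReal.inv_le_one.2 hc1) hr1) ?_
      rw [ENNReal.ofReal_rpow_of_nonneg (by positivity) hr0.le]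
      refine ENNReal.ofReal_le_ofReal ?_
      rw [Real.mul_rpow (by positivity) (by positivity), ← Real.rpow_mul two_pos.le,
        ← Real.rpow_mul hx0.le, ENNReal.toReal_inv]
      have e1 : -((k : ℝ) * ((γ + n) * (r x).toReal⁻¹)) * (r x).toReal = -(k * (γ + n)) := by
        field_simp
      have e2 : γ * (r x).toReal⁻¹ * (r x).toReal = γ := by field_simp
      rw [e1, e2]
      have e3 : (2 : ℝ) ^ (-((k : ℝ) * (γ + n))) = (((2 : ℝ) ^ k) ^ γ)⁻¹ * (((2 : ℝ) ^ k) ^ n)⁻¹ := by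
        rw [← Real.rpow_natCast, ← Real.rpow_intCast, ← Real.rpow_mul two_pos.le,
          ← Real.rpow_mul two_pos.le, ← Real.rpow_neg two_pos.le, ← Real.rpow_neg two_pos.le,
          ← Real.rpow_add two_pos]
        congr 1; ring
      rw [e3]
      have hpos : (0 : ℝ) < ((2 : ℝ) ^ k) ^ γ := by positivity
      calc (((2 : ℝ) ^ k) ^ γ)⁻¹ * (((2 : ℝ) ^ k) ^ n)⁻¹ * ‖x‖ ^ γ
          ≤ (((2 : ℝ) ^ k) ^ γ)⁻¹ * (((2 : ℝ) ^ k) ^ n)⁻¹ * (2 ^ |γ| * ((2 : ℝ) ^ k) ^ γ) :=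
            mul_le_mul_of_nonneg_left (norm_rpow_le_of_mem_annulus hxk γ) (by positivity)
        _ = _ := by field_simp
    · simp [rPiece, hxk, ENNReal.zero_rpow_of_pos hr0]
  have h1 : ∫⁻ x in {x | r x ≠ ∞}, (rPiece γ r k x / (V + 1)) ^ (r x).toReal ≤
      (V + 1)⁻¹ * V := by
    have hnull : NullMeasurableSet {x | r x ≠ ∞} volume :=
      (hr.aemeasurable.nullMeasurableSet_preimage (measurableSet_singleton ∞)).compl
    calc _ ≤ ∫⁻ x in {x | r x ≠ ∞}, (annulus n k).indicator
          (fun _ => (V + 1)⁻¹ * ENNReal.ofReal (2 ^ |γ| * (((2 : ℝ) ^ k) ^ n)⁻¹)) x := by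
          refine lintegral_mono_ae ?_
          rw [ae_restrict_iff'₀ hnull]
          exact ae_of_all _ hbound
      _ ≤ _ := setLIntegral_le_lintegral _ _
      _ = (V + 1)⁻¹ * ENNReal.ofReal (2 ^ |γ| * (((2 : ℝ) ^ k) ^ n)⁻¹) *
            volume (annulus n k) := lintegral_indicator_const (measurableSet_annulus k) _
      _ ≤ (V + 1)⁻¹ * ENNReal.ofReal (2 ^ |γ| * (((2 : ℝ) ^ k) ^ n)⁻¹) *
            (ENNReal.ofReal (((2 : ℝ) ^ k) ^ n) *
              volume (Metric.closedBall (0 : EuclideanSpace ℝ (Fin n)) 1)) :=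
          mul_le_mul' le_rfl (volume_annulus_le k)
      _ = (V + 1)⁻¹ * V := by
          have h2k : (0 : ℝ) < ((2 : ℝ) ^ k) ^ n := by positivity
          rw [hV, mul_assoc, ← mul_assoc (ENNReal.ofReal _) (ENNReal.ofReal _),
            ← ENNReal.ofReal_mul (by positivity), mul_assoc, inv_mul_cancel₀ h2k.ne', mul_one]
  have h2 : essSup (fun x => rPiece γ r k x / (V + 1)) (volume.restrict {x | r x = ∞}) ≤
      (V + 1)⁻¹ := by
    have hnull : NullMeasurableSet {x | r x = ∞} volume :=
      hr.aemeasurable.nullMeasurableSet_preimage (measurableSet_singleton ∞)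
    refine essSup_le_of_ae_le _ ?_
    change ∀ᵐ x ∂_, _
    rw [ae_restrict_iff'₀ hnull]
    refine ae_of_all _ fun x (hx : r x = ∞) => ?_
    by_cases hxk : x ∈ annulus n k
    · simp [rPiece, hxk, hx]
    · simp [rPiece, hxk]
  calc _ ≤ (V + 1)⁻¹ * V + (V + 1)⁻¹ := add_le_add h1 h2
    _ = (V + 1)⁻¹ * (V + 1) := by rw [mul_add, mul_one]
    _ = 1 := ENNReal.inv_mul_cancel hc0 hct

end RemainderFactor

/-! ### The integrand for a fixed parameter -/

section Integrand

variable {n m : ℕ} {Φ : EuclideanSpace ℝ (Fin n) → ℝ}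
  {A : Fin m → EuclideanSpace ℝ (Fin n) → Matrix (Fin n) (Fin n) ℝ}
  {b f : Fin m → EuclideanSpace ℝ (Fin n) → ℂ} {β γ : Fin m → ℝ}
  {α : Fin m → EuclideanSpace ℝ (Fin n) → ℝ} {q r : Fin m → EuclideanSpace ℝ (Fin n) → ℝ≥0∞}

theorem enorm_sub_act_le {A : Matrix (Fin n) (Fin n) ℝ} {b : EuclideanSpace ℝ (Fin n) → ℂ}
    {β : ℝ} (hβ : 0 < β) {B : ℝ≥0} (hB : HolderWith B β.toNNReal b) {k : ℤ}
    {x : EuclideanSpace ℝ (Fin n)} (hx : x ∈ annulus n k) :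
    ‖b x - b (act A x)‖ₑ ≤
      B * ENNReal.ofReal (matNorm (1 - A) ^ β) * ENNReal.ofReal ((2 : ℝ) ^ ((k : ℝ) * β)) := by
  have h1 : ‖b x - b (act A x)‖ₑ ≤ B * ‖x - act A x‖ₑ ^ β := by
    have := hB x (act A x)
    rwa [edist_eq_enorm_sub, edist_eq_enorm_sub, Real.coe_toNNReal _ hβ.le] at this
  have h2 : x - act A x = act (1 - A) x := by
    simp [act, Matrix.sub_mulVec]
  have h3 : ‖x - act A x‖ ≤ matNorm (1 - A) * 2 ^ k := by
    rw [h2]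
    exact (norm_act_le _ _).trans (mul_le_mul_of_nonneg_left hx.2 (matNorm_nonneg _))
  refine h1.trans ?_
  rw [mul_assoc, ← ENNReal.ofReal_mul (Real.rpow_nonneg (matNorm_nonneg _) _)]
  refine mul_le_mul' le_rfl ?_
  rw [← ofReal_norm, ENNReal.ofReal_rpow_of_nonneg (norm_nonneg _) hβ.le]
  refine ENNReal.ofReal_le_ofReal ((Real.rpow_le_rpow (norm_nonneg _) h3 hβ.le).trans_eq ?_)
  rw [Real.mul_rpow (matNorm_nonneg _) (by positivity), Real.rpow_mul two_pos.le,
    Real.rpow_intCast]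

theorem target_weight_eq {x : EuclideanSpace ℝ (Fin n)} (hx : 0 < ‖x‖) (k : ℤ) :
    (2 : ℝ) ^ ((k : ℝ) * alphaStar α β γ r x) * ‖x‖ ^ gammaTarget γ r x *
        ∏ i, (2 : ℝ) ^ ((k : ℝ) * β i) =
      (∏ i, (2 : ℝ) ^ ((k : ℝ) * α i x) * ‖x‖ ^ γ i) *
        ∏ i, (2 : ℝ) ^ (-((k : ℝ) * ((γ i + n) * ((r i x)⁻¹).toReal))) *
          ‖x‖ ^ (γ i * ((r i x)⁻¹).toReal) := by
  simp only [Finset.prod_mul_distrib]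
  rw [← Real.rpow_sum_of_pos two_pos, ← Real.rpow_sum_of_pos two_pos,
    ← Real.rpow_sum_of_pos two_pos, ← Real.rpow_sum_of_pos hx, ← Real.rpow_sum_of_pos hx]
  have h1 : (k : ℝ) * alphaStar α β γ r x = ∑ i, (k : ℝ) * α i x +
      ∑ i, -((k : ℝ) * ((γ i + n) * ((r i x)⁻¹).toReal)) - ∑ i, (k : ℝ) * β i := by
    simp only [alphaStar, ← Finset.mul_sum, Finset.sum_neg_distrib]
    ring
  rw [h1, gammaTarget, Real.rpow_sub two_pos, Real.rpow_add two_pos, Real.rpow_add hx]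
  have h2 : (0 : ℝ) < 2 ^ ∑ i, (k : ℝ) * β i := by positivity
  field_simp

theorem piece_commIntegrand_le (hΦ0 : ∀ t, 0 ≤ Φ t) (hβ : ∀ i, 0 < β i) {B : Fin m → ℝ≥0}
    (hB : ∀ i, HolderWith (B i) (β i).toNNReal (b i)) (k : ℤ) (t x : EuclideanSpace ℝ (Fin n)) :
    piece (alphaStar α β γ r) (fun x => ‖x‖ ^ gammaTarget γ r x)
        (fun x => ‖commIntegrand Φ A b f x t‖ₑ) k x ≤
      (ENNReal.ofReal (Φ t / ‖t‖ ^ n) *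
        ∏ i, (B i * ENNReal.ofReal (matNorm (1 - A i t) ^ β i))) *
        ((∏ i, piece (α i) (fun x => ‖x‖ ^ γ i) (fun x => ‖f i (act (A i t) x)‖ₑ) k x) *
          ∏ i, rPiece (γ i) (r i) k x) := by
  by_cases hx : x ∈ annulus n k
  · have hx0 := norm_pos_of_mem_annulus hx
    simp only [piece, rPiece, Set.indicator_of_mem hx]
    have hΦt : 0 ≤ Φ t / ‖t‖ ^ n := div_nonneg (hΦ0 t) (by positivity)
    have h1 : ‖commIntegrand Φ A b f x t‖ₑ ≤ ENNReal.ofReal (Φ t / ‖t‖ ^ n) *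
        (∏ i, ‖f i (act (A i t) x)‖ₑ) * ∏ i, (B i * ENNReal.ofReal (matNorm (1 - A i t) ^ β i) *
          ENNReal.ofReal ((2 : ℝ) ^ ((k : ℝ) * β i))) := by
      rw [commIntegrand, enorm_mul, enorm_mul]
      have e1 : ‖((Φ t / ‖t‖ ^ n : ℝ) : ℂ)‖ₑ = ENNReal.ofReal (Φ t / ‖t‖ ^ n) := by
        rw [← ofReal_norm, Complex.norm_real, Real.norm_of_nonneg hΦt]
      have e2 (g : Fin m → ℂ) : ‖∏ i, g i‖ₑ = ∏ i, ‖g i‖ₑ := by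
        simp only [← ofReal_norm, norm_prod]
        exact ENNReal.ofReal_prod_of_nonneg fun i _ => norm_nonneg _
      rw [e1, e2, e2]
      exact mul_le_mul' le_rfl (Finset.prod_le_prod' fun i _ => enorm_sub_act_le (hβ i) (hB i) hx)
    have h2 : ENNReal.ofReal (2 ^ ((k : ℝ) * alphaStar α β γ r x) * ‖x‖ ^ gammaTarget γ r x) *
          ∏ i, ENNReal.ofReal (2 ^ ((k : ℝ) * β i)) =
        (∏ i, ENNReal.ofReal (2 ^ ((k : ℝ) * α i x) * ‖x‖ ^ γ i)) *
          ∏ i, ENNReal.ofReal (2 ^ (-((k : ℝ) * ((γ i + n) * ((r i x)⁻¹).toReal))) *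
            ‖x‖ ^ (γ i * ((r i x)⁻¹).toReal)) := by
      rw [← ENNReal.ofReal_prod_of_nonneg (fun i _ => by positivity),
        ← ENNReal.ofReal_prod_of_nonneg (fun i _ => by positivity),
        ← ENNReal.ofReal_prod_of_nonneg (fun i _ => by positivity),
        ← ENNReal.ofReal_mul (by positivity), ← ENNReal.ofReal_mul (by positivity),
        target_weight_eq hx0]
    refine (mul_le_mul' le_rfl h1).trans (le_of_eq ?_)
    rw [Finset.prod_mul_distrib, Finset.prod_mul_distrib, Finset.prod_mul_distrib]
    calc _ = ENNReal.ofReal (Φ t / ‖t‖ ^ n) * ((∏ i, (B i : ℝ≥0∞)) *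
          ∏ i, ENNReal.ofReal (matNorm (1 - A i t) ^ β i)) * (∏ i, ‖f i (act (A i t) x)‖ₑ) *
          (ENNReal.ofReal (2 ^ (↑k * alphaStar α β γ r x) * ‖x‖ ^ gammaTarget γ r x) *
            ∏ i, ENNReal.ofReal (2 ^ (↑k * β i))) := by ring
      _ = _ := by rw [h2]; ring
  · simp [piece, hx]

/-- The target norm of the integrand at a fixed parameter: Hölder's inequality on each annulus with
the exponents `q_i`, `r_i`, followed by Hölder's inequality in the sequence spaces. -/
theorem lux_count_commIntegrand_le (hm : 0 < m) (hΦ0 : ∀ t, 0 ≤ Φ t) (hβ : ∀ i, 0 < β i)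
    {B : Fin m → ℝ≥0} (hB : ∀ i, HolderWith (B i) (β i).toNNReal (b i))
    (hq : ∀ i, IsBoundedExponent (q i)) (hr : ∀ i, IsExponent (r i))
    (hqT : IsBoundedExponent (qTarget q r)) (hα : ∀ i, AEMeasurable (α i) volume)
    {c : Fin m → ℝ≥0} (hc : ∀ i k, lux volume (r i) (rPiece (γ i) (r i) k) ≤ c i)
    {p : ℝ} (hp : 1 ≤ p) {P : Fin m → ℝ} (hP : ∀ i, 1 ≤ P i) (hpP : ∑ i, 1 / P i = 1 / p)
    (t : EuclideanSpace ℝ (Fin n))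
    (hfA : ∀ i, AEMeasurable (fun x => ‖f i (act (A i t) x)‖ₑ) volume)
    (hfin : ∀ i, lux Measure.count (fun _ => ENNReal.ofReal (P i)) (fun k : ℤ =>
      lux volume (q i) (piece (α i) (fun x => ‖x‖ ^ γ i)
        (fun x => ‖f i (act (A i t) x)‖ₑ) k)) ≠ ∞) :
    lux Measure.count (fun _ => ENNReal.ofReal p) (fun k : ℤ => lux volume (qTarget q r)
      (piece (alphaStar α β γ r) (fun x => ‖x‖ ^ gammaTarget γ r x)
        (fun x => ‖commIntegrand Φ A b f x t‖ₑ) k)) ≤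
      (((m + m : ℕ) : ℝ≥0∞) * (∏ i, (c i : ℝ≥0∞)) * m) *
        (ENNReal.ofReal (Φ t / ‖t‖ ^ n) *
          ∏ i, (B i * ENNReal.ofReal (matNorm (1 - A i t) ^ β i))) *
        ∏ i, lux Measure.count (fun _ => ENNReal.ofReal (P i)) (fun k : ℤ =>
          lux volume (q i) (piece (α i) (fun x => ‖x‖ ^ γ i)
            (fun x => ‖f i (act (A i t) x)‖ₑ) k)) := by
  have : Nonempty (Fin m) := ⟨⟨0, hm⟩⟩
  have hP0 (i) : 0 < P i := zero_lt_one.trans_le (hP i)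
  have hp0 : 0 < p := zero_lt_one.trans_le hp
  set D : Fin m → ℤ → ℝ≥0∞ := fun i k => lux volume (q i) (piece (α i) (fun x => ‖x‖ ^ γ i)
    (fun x => ‖f i (act (A i t) x)‖ₑ) k) with hD
  have hDt (i k) : D i k ≠ ∞ := ne_top_of_le_ne_top (hfin i) (le_lux_count (hP0 i) (D i) k)
  set M := ENNReal.ofReal (Φ t / ‖t‖ ^ n) *
    ∏ i, (B i * ENNReal.ofReal (matNorm (1 - A i t) ^ β i)) with hM
  have hMt : M ≠ ∞ := ENNReal.mul_ne_top ENNReal.ofReal_ne_top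
    (ENNReal.prod_ne_top fun i _ => ENNReal.mul_ne_top ENNReal.coe_ne_top ENNReal.ofReal_ne_top)
  have hstep (k : ℤ) : lux volume (qTarget q r)
      (piece (alphaStar α β γ r) (fun x => ‖x‖ ^ gammaTarget γ r x)
        (fun x => ‖commIntegrand Φ A b f x t‖ₑ) k) ≤
      (M * (((m + m : ℕ) : ℝ≥0∞) * ∏ i, (c i : ℝ≥0∞))) * ∏ i, D i k := by
    refine (lux_mono (ae_of_all _ fun x =>
      piece_commIntegrand_le hΦ0 hβ hB k t x)).trans ?_
    refine (lux_const_mul_le hqT.ne_zero hqT.ne_top hMt).trans ?_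
    refine (mul_le_mul' le_rfl ?_).trans_eq (mul_assoc M _ _).symm
    have key := lux_prod_le (μ := (volume : Measure (EuclideanSpace ℝ (Fin n))))
      (ι := Fin m ⊕ Fin m) (s := qTarget q r) (e := Sum.elim q r)
      (g := Sum.elim (fun i => piece (α i) (fun x => ‖x‖ ^ γ i)
        (fun x => ‖f i (act (A i t) x)‖ₑ) k) (fun i => rPiece (γ i) (r i) k))
      hqT.one_le hqT.ne_top (ae_of_all _ fun x => by simp [qTarget]) ?_ ?_ ?_
    · simp only [Fintype.prod_sum_type, Sum.elim_inl, Sum.elim_inr, Fintype.card_sum,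
        Fintype.card_fin] at key
      refine key.trans ?_
      rw [mul_assoc]
      refine mul_le_mul' le_rfl ?_
      rw [mul_comm]
      exact mul_le_mul' (Finset.prod_le_prod' fun i _ => hc i k) le_rfl
    · rintro (i | i)
      · exact (hq i).aemeasurable
      · exact (hr i).aemeasurable
    · rintro (i | i)
      · exact aemeasurable_piece (hα i) (aemeasurable_norm_rpow _) (hfA i) k
      · exact aemeasurable_rPiece (hr i).aemeasurable k
    · rintro (i | i)
      · exact hDt i k
      · exact ne_top_of_le_ne_top ENNReal.coe_ne_top (hc i k)
  have h1 (x : ℤ) : 1 ≤ ENNReal.ofReal p := by simpa using hp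
  have h0 (x : ℤ) : ENNReal.ofReal p ≠ 0 := by simpa using hp0
  have ht (x : ℤ) : ENNReal.ofReal p ≠ ∞ := ENNReal.ofReal_ne_top
  refine (lux_mono (ae_of_all _ hstep)).trans ?_
  refine (lux_const_mul_le h0 ht (ENNReal.mul_ne_top hMt (ENNReal.mul_ne_top
    (ENNReal.natCast_ne_top _) (ENNReal.prod_ne_top fun _ _ => ENNReal.coe_ne_top)))).trans ?_
  have key := lux_prod_le (μ := (Measure.count : Measure ℤ)) (ι := Fin m)
    (s := fun _ => ENNReal.ofReal p) (e := fun i _ => ENNReal.ofReal (P i)) (g := D) h1 ht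
    (ae_of_all _ fun k => ?_) (fun i => aemeasurable_const)
    (fun i => (measurable_of_countable _).aemeasurable) hfin
  · refine (mul_le_mul' le_rfl key).trans (le_of_eq ?_)
    rw [Fintype.card_fin]
    ring
  · have h2 (i : Fin m) : (ENNReal.ofReal (P i))⁻¹ = ENNReal.ofReal (1 / P i) := by
      rw [one_div, ENNReal.ofReal_inv_of_pos (hP0 i)]
    simp only [h2]
    rw [← ENNReal.ofReal_sum_of_nonneg (fun i _ => by have := hP0 i; positivity), hpP, one_div,
      ENNReal.ofReal_inv_of_pos hp0]

end Integrand

/-! ### Joint measurability of the integrand -/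

section Measurability

variable {n m : ℕ} {Φ : EuclideanSpace ℝ (Fin n) → ℝ}
  {A : Fin m → EuclideanSpace ℝ (Fin n) → Matrix (Fin n) (Fin n) ℝ}
  {b f : Fin m → EuclideanSpace ℝ (Fin n) → ℂ}

theorem measurable_act_uncurry {A : EuclideanSpace ℝ (Fin n) → Matrix (Fin n) (Fin n) ℝ}
    (hA : ∀ j k, Measurable fun t => A t j k) :
    Measurable fun z : EuclideanSpace ℝ (Fin n) × EuclideanSpace ℝ (Fin n) => act (A z.1) z.2 := by
  refine (WithLp.measurable_toLp 2 (Fin n → ℝ)).comp (measurable_pi_lambda _ fun j => ?_)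
  simp only [Matrix.mulVec, dotProduct]
  refine Finset.measurable_sum _ fun k _ => ((hA j k).comp measurable_fst).mul ?_
  exact (measurable_pi_apply k).comp ((WithLp.measurable_ofLp 2 (Fin n → ℝ)).comp measurable_snd)

theorem measurable_commIntegrand (hΦ : Measurable Φ) (hA : ∀ i j k, Measurable fun t => A i t j k)
    (hb : ∀ i, Measurable (b i)) (hf : ∀ i, Measurable (f i)) :
    Measurable fun z : EuclideanSpace ℝ (Fin n) × EuclideanSpace ℝ (Fin n) =>
      commIntegrand Φ A b f z.2 z.1 := by
  have hact (i) := measurable_act_uncurry (hA i)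
  refine ((Complex.measurable_ofReal.comp ((hΦ.comp measurable_fst).div
    (measurable_fst.norm.pow_const n))).mul
    (Finset.measurable_prod _ fun i _ => (hf i).comp (hact i))).mul
    (Finset.measurable_prod _ fun i _ => ?_)
  exact ((hb i).comp measurable_snd).sub ((hb i).comp (hact i))

/-- Where `Φ(t) ≠ 0` the matrix `A_i(t)` is invertible, so that a change of `f_i` on a null set
affects `f_i(A_i(t) x)` only on a null set of such `(t, x)`; elsewhere the integrand vanishes. -/
theorem aemeasurable_commIntegrand (hΦ : AEMeasurable Φ volume)
    (hA : ∀ i j k, AEMeasurable (fun t => A i t j k) volume)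
    (hAinv : ∀ i, ∀ᵐ t, Φ t ≠ 0 → IsUnit (A i t)) (hb : ∀ i, Measurable (b i))
    (hf : ∀ i, AEMeasurable (f i) volume) :
    AEMeasurable (fun z : EuclideanSpace ℝ (Fin n) × EuclideanSpace ℝ (Fin n) =>
      commIntegrand Φ A b f z.2 z.1) (volume.prod volume) := by
  set A' : Fin m → EuclideanSpace ℝ (Fin n) → Matrix (Fin n) (Fin n) ℝ :=
    fun i t => Matrix.of fun j k => (hA i j k).mk _ t with hA'
  have hA'm (i j k) : Measurable fun t => A' i t j k := (hA i j k).measurable_mk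
  have hAA' : ∀ᵐ t, ∀ i, A i t = A' i t := by
    refine ae_all_iff.2 fun i => ?_
    have h : ∀ᵐ t, ∀ j k, A i t j k = (hA i j k).mk _ t :=
      ae_all_iff.2 fun j => ae_all_iff.2 fun k => (hA i j k).ae_eq_mk
    filter_upwards [h] with t ht
    ext j k
    exact ht j k
  refine ⟨fun z => commIntegrand (hΦ.mk Φ) A' b (fun i => (hf i).mk (f i)) z.2 z.1,
    measurable_commIntegrand hΦ.measurable_mk hA'm hb fun i => (hf i).measurable_mk, ?_⟩
  have hbad (i) : ∀ᵐ z ∂((volume : Measure (EuclideanSpace ℝ (Fin n))).prod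
      (volume : Measure (EuclideanSpace ℝ (Fin n)))), hΦ.mk Φ z.1 ≠ 0 →
        f i (act (A' i z.1) z.2) = (hf i).mk (f i) (act (A' i z.1) z.2) := by
    set Z := toMeasurable volume {y | f i y ≠ (hf i).mk (f i) y} with hZ
    have hZ0 : volume Z = 0 := by
      rw [hZ, measure_toMeasurable]
      exact (hf i).ae_eq_mk
    set S : Set (EuclideanSpace ℝ (Fin n) × EuclideanSpace ℝ (Fin n)) :=
      {z | hΦ.mk Φ z.1 ≠ 0} ∩ {z | act (A' i z.1) z.2 ∈ Z} with hS
    have hSm : MeasurableSet S :=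
      ((hΦ.measurable_mk.comp measurable_fst) (measurableSet_singleton 0).compl).inter
        (measurable_act_uncurry (hA'm i) (measurableSet_toMeasurable _ _))
    have hS0 : ((volume : Measure (EuclideanSpace ℝ (Fin n))).prod
        (volume : Measure (EuclideanSpace ℝ (Fin n)))) S = 0 := by
      rw [Measure.measure_prod_null hSm]
      filter_upwards [hΦ.ae_eq_mk, hAA', hAinv i] with t h1 h2 h3
      by_cases h0 : hΦ.mk Φ t = 0
      · have : Prod.mk t ⁻¹' S = ∅ := by
          ext x; simp [hS, h0]
        simp [this]
      · have hu : IsUnit (A' i t) := h2 i ▸ h3 (by rwa [h1])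
        refine measure_mono_null (fun x hx => ?_) ((quasiMeasurePreserving_act hu).preimage_null hZ0)
        exact hx.2
    refine measure_mono_null (fun z hz => ?_) hS0
    change ¬ (_ → _) at hz
    rw [Classical.not_imp] at hz
    exact ⟨hz.1, subset_toMeasurable _ _ hz.2⟩
  have hfst : ∀ᵐ z ∂((volume : Measure (EuclideanSpace ℝ (Fin n))).prod
      (volume : Measure (EuclideanSpace ℝ (Fin n)))),
      Φ z.1 = hΦ.mk Φ z.1 ∧ ∀ i, A i z.1 = A' i z.1 :=
    Measure.quasiMeasurePreserving_fst.ae (hΦ.ae_eq_mk.and hAA')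
  filter_upwards [hfst, ae_all_iff.2 hbad] with z h1 h2
  simp only [commIntegrand, h1.1, h1.2]
  by_cases h0 : hΦ.mk Φ z.1 = 0
  · simp [h0]
  · simp only [h2 _ h0]

end Measurability

/-! ### The estimate of the commutator -/

section Commutator

variable {n m : ℕ} {Φ : EuclideanSpace ℝ (Fin n) → ℝ}
  {A : Fin m → EuclideanSpace ℝ (Fin n) → Matrix (Fin n) (Fin n) ℝ}
  {b f : Fin m → EuclideanSpace ℝ (Fin n) → ℂ} {β γ : Fin m → ℝ}
  {α : Fin m → EuclideanSpace ℝ (Fin n) → ℝ} {q r : Fin m → EuclideanSpace ℝ (Fin n) → ℝ≥0∞}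

theorem ae_lt_top_of_lux_ne_top {X : Type*} [MeasurableSpace X] {μ : Measure X} {p g : X → ℝ≥0∞}
    (hp : AEMeasurable p μ) (hp0 : ∀ x, p x ≠ 0) (hpt : ∀ x, p x ≠ ∞) (hg : AEMeasurable g μ)
    (h : lux μ p g ≠ ∞) : ∀ᵐ x ∂μ, g x < ∞ := by
  obtain ⟨c, hc1, hc2⟩ := exists_between (lt_top_iff_ne_top.2 h)
  have h1 := emodular_div_le_of_lux_lt hc1
  rw [emodular_of_ne_top hpt] at h1
  filter_upwards [ae_lt_top' ((hg.div_const c).pow hp.ennreal_toReal)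
    (ne_top_of_le_ne_top ENNReal.one_ne_top h1)] with x hx
  rw [ENNReal.rpow_lt_top_iff_of_pos (ENNReal.toReal_pos (hp0 x) (hpt x))] at hx
  by_contra hgx
  rw [not_lt_top_iff] at hgx
  simp [hgx, ENNReal.top_div, hc2.ne] at hx

theorem ae_lt_top_of_lux_piece_ne_top (hn : 0 < n) {a w : EuclideanSpace ℝ (Fin n) → ℝ}
    {p g : EuclideanSpace ℝ (Fin n) → ℝ≥0∞} (hp : IsBoundedExponent p) (ha : AEMeasurable a volume)
    (hw : AEMeasurable w volume) (hw0 : ∀ x, x ≠ 0 → 0 < w x) (hg : AEMeasurable g volume)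
    (h : ∀ k, lux volume p (piece a w g k) ≠ ∞) : ∀ᵐ x, g x < ∞ := by
  have : Nonempty (Fin n) := ⟨⟨0, hn⟩⟩
  have hx0 : ∀ᵐ x : EuclideanSpace ℝ (Fin n), x ≠ 0 :=
    compl_mem_ae_iff.2 (measure_singleton 0)
  have h1 : ∀ᵐ x, ∀ k, piece a w g k x < ∞ := ae_all_iff.2 fun k =>
    ae_lt_top_of_lux_ne_top hp.aemeasurable hp.ne_zero hp.ne_top (aemeasurable_piece ha hw hg k) (h k)
  filter_upwards [hx0, h1] with x hx hx'
  obtain ⟨k, hk⟩ := exists_mem_annulus hx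
  have h2 := hx' k
  simp only [piece, Set.indicator_of_mem hk] at h2
  by_contra hgx
  rw [not_lt_top_iff] at hgx
  have h3 : 0 < (2 : ℝ) ^ ((k : ℝ) * a x) * w x := mul_pos (by positivity) (hw0 x hx)
  rw [hgx, ENNReal.mul_top (by simpa using h3)] at h2
  exact lt_irrefl _ h2

theorem LogHolderAtZero.exists_abs_le {a : EuclideanSpace ℝ (Fin n) → ℝ} (h : LogHolderAtZero a) :
    ∃ M, ∀ x, |a x| ≤ M := by
  obtain ⟨C, hC⟩ := h
  refine ⟨|a 0| + |C|, fun x => ?_⟩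
  have h1 : 1 ≤ Real.log (Real.exp 1 + 1 / ‖x‖) := by
    have h0 : 0 ≤ 1 / ‖x‖ := by positivity
    rw [Real.le_log_iff_exp_le (by positivity)]
    linarith
  have h2 : C / Real.log (Real.exp 1 + 1 / ‖x‖) ≤ |C| :=
    (div_le_div_of_nonneg_right (le_abs_self C) (by linarith)).trans
      (div_le_self (abs_nonneg _) h1)
  have h3 := abs_add_le (a x - a 0) (a 0)
  rw [sub_add_cancel] at h3
  linarith [hC x]

/-- On a fixed annulus, bounded exponents make the Herz weight bounded from below. -/
theorem exists_le_mul_piece {a w : EuclideanSpace ℝ (Fin n) → ℝ} {M M' : ℝ}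
    (ha : ∀ x, |a x| ≤ M) (hw : ∀ x, |w x| ≤ M') (g : EuclideanSpace ℝ (Fin n) → ℝ≥0∞) (k : ℤ) :
    ∃ c : ℝ≥0, ∀ x ∈ annulus n k, g x ≤ c * piece a (fun x => ‖x‖ ^ w x) g k x := by
  set κ : ℝ := 2 ^ (|(k : ℝ)| * M + (|(k : ℝ)| + 1) * M') with hκ
  have hκ0 : 0 < κ := by positivity
  refine ⟨κ.toNNReal, fun x hx => ?_⟩
  simp only [piece, Set.indicator_of_mem hx]
  have hx0 := norm_pos_of_mem_annulus hx
  have h1 : 1 ≤ κ * (2 ^ ((k : ℝ) * a x) * ‖x‖ ^ w x) := by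
    set ℓ := Real.logb 2 ‖x‖ with hl
    have hx2 : ‖x‖ = 2 ^ ℓ := (Real.rpow_logb two_pos (by norm_num) hx0).symm
    have hl1 : (k : ℝ) - 1 ≤ ℓ := by
      have := hx.1
      rw [hx2, ← Real.rpow_intCast] at this
      have := (Real.rpow_lt_rpow_left_iff (one_lt_two (α := ℝ))).1 this
      push_cast at this
      exact this.le
    have hl2 : ℓ ≤ k := by
      have := hx.2
      rw [hx2, ← Real.rpow_intCast] at this
      exact (Real.rpow_le_rpow_left_iff (one_lt_two (α := ℝ))).1 this
    have hl3 : |ℓ| ≤ |(k : ℝ)| + 1 := by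
      rw [abs_le]
      constructor <;> linarith [neg_abs_le (k : ℝ), le_abs_self (k : ℝ)]
    rw [hx2, ← Real.rpow_mul two_pos.le, ← Real.rpow_add two_pos, hκ, ← Real.rpow_add two_pos]
    refine Real.one_le_rpow one_le_two ?_
    have h2 : |(k : ℝ) * a x| ≤ |(k : ℝ)| * M := by
      rw [abs_mul]; exact mul_le_mul_of_nonneg_left (ha x) (abs_nonneg _)
    have h3 : |ℓ * w x| ≤ (|(k : ℝ)| + 1) * M' := by
      rw [abs_mul]; exact mul_le_mul hl3 (hw x) (abs_nonneg _) (by positivity)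
    linarith [neg_abs_le ((k : ℝ) * a x), neg_abs_le (ℓ * w x)]
  have h2 : ((κ.toNNReal : ℝ≥0) : ℝ≥0∞) = ENNReal.ofReal κ := rfl
  rw [h2, ← mul_assoc, ← ENNReal.ofReal_mul hκ0.le]
  calc g x = 1 * g x := (one_mul _).symm
    _ ≤ _ := mul_le_mul' (by simpa using ENNReal.ofReal_le_ofReal h1) le_rfl

/-- Finite norms on the annuli give finite norms on compact sets that avoid the origin, because such
a set meets finitely many annuli. -/
theorem varNorm_indicator_lt_top {a w : EuclideanSpace ℝ (Fin n) → ℝ} {M M' : ℝ}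
    (ham : AEMeasurable a volume) (hwm : AEMeasurable w volume)
    (ha : ∀ x, |a x| ≤ M) (hw : ∀ x, |w x| ≤ M') {p : EuclideanSpace ℝ (Fin n) → ℝ≥0∞}
    (hp : IsBoundedExponent p) {h : EuclideanSpace ℝ (Fin n) → ℂ} (hh : AEMeasurable h volume)
    (hfin : ∀ k, lux volume p (piece a (fun x => ‖x‖ ^ w x) (fun x => ‖h x‖ₑ) k) ≠ ∞)
    {K : Set (EuclideanSpace ℝ (Fin n))} (hK : IsCompact K) (h0 : 0 ∉ K) :
    varNorm p (K.indicator h) < ∞ := by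
  choose c hc using exists_le_mul_piece ha hw (fun x => ‖h x‖ₑ)
  obtain ⟨s, hs⟩ : ∃ s : Finset ℤ, ∀ x ∈ K, ∃ k ∈ s, x ∈ annulus n k := by
    obtain ⟨R, hR⟩ := hK.isBounded.exists_norm_le
    obtain ⟨δ, hδ, hδK⟩ : ∃ δ > 0, ∀ x ∈ K, δ ≤ ‖x‖ := by
      have hopen : Kᶜ ∈ 𝓝 (0 : EuclideanSpace ℝ (Fin n)) := hK.isClosed.isOpen_compl.mem_nhds h0
      obtain ⟨δ, hδ, hball⟩ := Metric.mem_nhds_iff.1 hopen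
      refine ⟨δ, hδ, fun x hx => ?_⟩
      by_contra hlt
      exact hball (by simpa using hlt) hx
    obtain ⟨k₁, hk₁⟩ := exists_mem_Ioc_zpow hδ (one_lt_two (α := ℝ))
    obtain ⟨k₂, hk₂⟩ := exists_mem_Ioc_zpow (show 0 < max R 1 by positivity)
      (one_lt_two (α := ℝ))
    refine ⟨Finset.Icc k₁ (k₂ + 1), fun x hx => ?_⟩
    have hxδ := hδK x hx
    obtain ⟨k, hk⟩ := exists_mem_annulus (norm_pos_iff.1 (hδ.trans_le hxδ))
    refine ⟨k, Finset.mem_Icc.2 ⟨?_, ?_⟩, hk⟩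
    · have : (2 : ℝ) ^ k₁ < 2 ^ k := hk₁.1.trans_le (hxδ.trans hk.2)
      exact ((zpow_lt_zpow_iff_right₀ (one_lt_two (α := ℝ))).1 this).le
    · exact le_of_mem_annulus hk ((hR x hx).trans ((le_max_left _ _).trans hk₂.2))
  rw [varNorm_eq_lux]
  have hm (k : ℤ) : AEMeasurable (piece a (fun x => ‖x‖ ^ w x) (fun x => ‖h x‖ₑ) k) volume :=
    aemeasurable_piece ham (measurable_norm.aemeasurable.pow hwm) hh.enorm k
  calc lux volume p (fun x => ‖K.indicator h x‖ₑ)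
      ≤ lux volume p (fun x => ∑ k ∈ s, c k * piece a (fun x => ‖x‖ ^ w x) (fun x => ‖h x‖ₑ) k x) := by
        refine lux_mono (ae_of_all _ fun x => ?_)
        by_cases hx : x ∈ K
        · obtain ⟨k, hks, hk⟩ := hs x hx
          beta_reduce
          rw [Set.indicator_of_mem hx]
          exact (hc k x hk).trans (Finset.single_le_sum
            (f := fun k => (c k : ℝ≥0∞) * piece a (fun x => ‖x‖ ^ w x) (fun x => ‖h x‖ₑ) k x)
            (fun _ _ => zero_le) hks)
        · simp [hx]
    _ ≤ ∑ k ∈ s, lux volume p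
          (fun x => c k * piece a (fun x => ‖x‖ ^ w x) (fun x => ‖h x‖ₑ) k x) :=
        lux_sum_le _ hp.aemeasurable hp.one_le hp.ne_top fun k _ => (hm k).const_mul _
    _ ≤ ∑ k ∈ s, c k * lux volume p (piece a (fun x => ‖x‖ ^ w x) (fun x => ‖h x‖ₑ) k) :=
        Finset.sum_le_sum fun k _ => lux_const_mul_le hp.ne_zero hp.ne_top ENNReal.coe_ne_top
    _ < ∞ := ENNReal.sum_lt_top.2 fun k _ =>
        ENNReal.mul_lt_top ENNReal.coe_lt_top (hfin k).lt_top

theorem abs_gammaTarget_le (hr : ∀ i, IsExponent (r i)) (x : EuclideanSpace ℝ (Fin n)) :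
    |gammaTarget γ r x| ≤ |∑ i, γ i| + ∑ i, |γ i| := by
  refine (abs_add_le _ _).trans (add_le_add le_rfl ?_)
  refine (Finset.abs_sum_le_sum_abs _ _).trans (Finset.sum_le_sum fun i _ => ?_)
  have h1 : ((r i x)⁻¹).toReal ≤ 1 := by
    simpa using ENNReal.toReal_mono ENNReal.one_ne_top (ENNReal.inv_le_one.2 ((hr i).one_le x))
  rw [abs_mul, abs_of_nonneg ENNReal.toReal_nonneg]
  exact mul_le_of_le_one_right (abs_nonneg _) h1

theorem aemeasurable_gammaTarget (hr : ∀ i, IsExponent (r i)) :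
    AEMeasurable (gammaTarget γ r) volume :=
  aemeasurable_const.add (Finset.aemeasurable_fun_sum _ fun i _ =>
    (hr i).aemeasurable.inv.ennreal_toReal.const_mul _)

/-- Minkowski's integral inequality for the Herz norm. -/
theorem lux_count_piece_lintegral_le {a w : EuclideanSpace ℝ (Fin n) → ℝ}
    {s : EuclideanSpace ℝ (Fin n) → ℝ≥0∞} (hs : IsBoundedExponent s) (ha : AEMeasurable a volume)
    (hw : AEMeasurable w volume) {p : ℝ} (hp : 1 ≤ p)
    {g : EuclideanSpace ℝ (Fin n) → EuclideanSpace ℝ (Fin n) → ℝ≥0∞}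
    (hg : AEMeasurable (Function.uncurry g) (volume.prod volume)) :
    lux Measure.count (fun _ => ENNReal.ofReal p) (fun k : ℤ =>
        lux volume s (piece a w (fun x => ∫⁻ t, g t x) k)) ≤
      ∫⁻ t, lux Measure.count (fun _ => ENNReal.ofReal p) (fun k : ℤ =>
        lux volume s (piece a w (g t) k)) := by
  have hG (k : ℤ) : AEMeasurable (Function.uncurry fun t x => piece a w (g t) k x)
      ((volume : Measure (EuclideanSpace ℝ (Fin n))).prod volume) := by
    have h1 : AEMeasurable (fun x => ENNReal.ofReal ((2 : ℝ) ^ ((k : ℝ) * a x) * w x)) volume :=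
      ((aemeasurable_const.pow (ha.const_mul _)).mul hw).ennreal_ofReal
    refine ((h1.comp_snd.mul hg).indicator
      (measurable_snd (measurableSet_annulus k))).congr (ae_of_all _ fun z => ?_)
    rfl
  have hint (k : ℤ) : piece a w (fun x => ∫⁻ t, g t x) k =
      fun x => ∫⁻ t, piece a w (g t) k x := by
    ext x
    by_cases hx : x ∈ annulus n k
    · simp only [piece, Set.indicator_of_mem hx]
      rw [lintegral_const_mul' _ _ ENNReal.ofReal_ne_top]
    · simp [piece, hx]
  calc _ ≤ lux Measure.count (fun _ => ENNReal.ofReal p) (fun k : ℤ =>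
        ∫⁻ t, lux volume s (piece a w (g t) k)) := by
        refine lux_mono (ae_of_all _ fun k => ?_)
        beta_reduce
        rw [hint k]
        exact lux_lintegral_le hs.aemeasurable hs.one_le hs.ne_top (hG k)
    _ ≤ _ := by
        refine lux_lintegral_le aemeasurable_const (fun _ => by simpa using hp)
          (fun _ => ENNReal.ofReal_ne_top) (G := fun t (k : ℤ) => lux volume s (piece a w (g t) k)) ?_
        exact aemeasurable_prod_of_countable fun k =>
          aemeasurable_lux hs.aemeasurable hs.one_le hs.ne_top (hG k)

/-- The target Herz norm of the integrand at a parameter `t` with invertible `A_i(t)`, in terms of the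
integrand of `constC2`. The factor `(2 - Θ) ^ (m - 1 / p)` is at least one and is not needed,
because the triangle inequality in `ℓ^{p_i}` already sums over `Θ - 1 ≤ ρ ≤ 0`. -/
theorem lux_count_commIntegrand_le_constC2 (hn : 0 < n) (hm : 0 < m) (hΦ0 : ∀ t, 0 ≤ Φ t)
    (hβ : ∀ i, 0 < β i) {B : Fin m → ℝ≥0} (hB : ∀ i, HolderWith (B i) (β i).toNNReal (b i))
    {ζ : ℝ} (hq : ∀ i, IsBoundedExponent (q i)) (hr : ∀ i, IsExponent (r i))
    (hqT : IsBoundedExponent (qTarget q r)) (hα : ∀ i, AEMeasurable (α i) volume)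
    {C : Fin m → ℝ}
    (hC : ∀ i, ∀ (k : ℤ), ∀ x ∈ annulus n k, |(k : ℝ) * (α i x - α i 0)| ≤ C i)
    {c : Fin m → ℝ≥0} (hc : ∀ i k, lux volume (r i) (rPiece (γ i) (r i) k) ≤ c i)
    {p : ℝ} (hp : 1 ≤ p) {P : Fin m → ℝ} (hP : ∀ i, 1 ≤ P i) (hpP : ∑ i, 1 / P i = 1 / p)
    (hf : ∀ i, AEMeasurable (f i) volume)
    (hfin : ∀ i, herzNorm (α i) (P i) (fun x => ENNReal.ofReal ζ * q i x) (fun x => ‖x‖ ^ γ i)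
      (f i) ≠ ∞)
    {t : EuclideanSpace ℝ (Fin n)} (hA : ∀ i, IsUnit (A i t))
    (hqζ : ∀ i, ∀ᵐ x, q i (act (A i t)⁻¹ x) ≤ ENNReal.ofReal ζ * q i x)
    (hϑ : ∀ i, varNorm (theta ζ (q i) (A i t)) (fun _ => 1) < ∞) :
    lux Measure.count (fun _ => ENNReal.ofReal p) (fun k : ℤ => lux volume (qTarget q r)
      (piece (alphaStar α β γ r) (fun x => ‖x‖ ^ gammaTarget γ r x)
        (fun x => ‖commIntegrand Φ A b f x t‖ₑ) k)) ≤
      (((m + m : ℕ) : ℝ≥0∞) * (∏ i, (c i : ℝ≥0∞)) * m * (∏ i, (B i : ℝ≥0∞)) *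
        (∏ i, ENNReal.ofReal (2 * 2 ^ (2 * C i + |α i 0|))) *
        ∏ i, herzNorm (α i) (P i) (fun x => ENNReal.ofReal ζ * q i x) (fun x => ‖x‖ ^ γ i)
          (f i)) *
      (ENNReal.ofReal
        ((2 - (thetaStar fun i => A i t : ℝ)) ^ ((m : ℝ) - 1 / p) * (Φ t / ‖t‖ ^ n)) *
        ∏ i, (ENNReal.ofReal (cFactor (A i t) (q i) (γ i) * matNorm (1 - A i t) ^ β i) *
          varNorm (theta ζ (q i) (A i t)) (fun _ => 1) *
          ENNReal.ofReal (phiFactor (A i t) (thetaStar fun i => A i t) 0 (α i 0) (α i 0)))) := by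
  have hP0 (i) : 0 < P i := zero_lt_one.trans_le (hP i)
  have hp0 : 0 < p := zero_lt_one.trans_le hp
  obtain ⟨hΘ, hΘ1⟩ := thetaStar_spec hn hm hA
  set Θ := thetaStar fun i => A i t with hΘdef
  have hN (i) : varNorm (theta ζ (q i) (A i t)) (fun _ => 1) =
      lux volume (theta ζ (q i) (A i t)) (fun _ => 1) := by
    rw [varNorm_eq_lux]; simp
  have hH (i) : herzNorm (α i) (P i) (fun x => ENNReal.ofReal ζ * q i x) (fun x => ‖x‖ ^ γ i)
      (f i) = lux Measure.count (fun _ => ENNReal.ofReal (P i)) (fun k : ℤ =>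
        lux volume (fun x => ENNReal.ofReal ζ * q i x)
          (piece (α i) (fun x => ‖x‖ ^ γ i) (fun x => ‖f i x‖ₑ) k)) :=
    herzNorm_eq_lux (fun x => by positivity) (hP0 i) _ _
  have hD (i) := lux_count_piece_comp_act_le (γ := γ i) hn (hA i) (hΘ i) (hα i) (hC i) (hq i)
    (hqζ i) ((hN i) ▸ (hϑ i).ne) (hf i).enorm (hP i) ((hH i) ▸ hfin i)
  have hfin' (i) : lux Measure.count (fun _ => ENNReal.ofReal (P i)) (fun k : ℤ =>
      lux volume (q i) (piece (α i) (fun x => ‖x‖ ^ γ i)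
        (fun x => ‖f i (act (A i t) x)‖ₑ) k)) ≠ ∞ := by
    refine ne_top_of_le_ne_top ?_ (hD i)
    rw [← hN i, ← hH i]
    exact ENNReal.mul_ne_top (ENNReal.mul_ne_top ENNReal.ofReal_ne_top (ENNReal.mul_ne_top
      (ENNReal.mul_ne_top ENNReal.ofReal_ne_top (hϑ i).ne) ENNReal.ofReal_ne_top)) (hfin i)
  have h1 := lux_count_commIntegrand_le (Φ := Φ) (A := A) (f := f) hm hΦ0 hβ hB hq hr hqT hα hc hp
    hP hpP t
    (fun i => ((hf i).enorm).comp_quasiMeasurePreserving (quasiMeasurePreserving_act (hA i))) hfin'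
  have h2 : 1 ≤ (2 - (Θ : ℝ)) ^ ((m : ℝ) - 1 / p) := by
    have h3 : (Θ : ℝ) ≤ -1 := by exact_mod_cast hΘ1
    refine Real.one_le_rpow (by linarith) ?_
    rw [← hpP, sub_nonneg]
    calc ∑ i, 1 / P i ≤ ∑ _i : Fin m, (1 : ℝ) :=
          Finset.sum_le_sum fun i _ => (div_le_one (hP0 i)).2 (hP i)
      _ = m := by simp
  have hΦt : 0 ≤ Φ t / ‖t‖ ^ n := div_nonneg (hΦ0 t) (by positivity)
  have h4 : ENNReal.ofReal (Φ t / ‖t‖ ^ n) ≤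
      ENNReal.ofReal ((2 - (Θ : ℝ)) ^ ((m : ℝ) - 1 / p) * (Φ t / ‖t‖ ^ n)) :=
    ENNReal.ofReal_le_ofReal (le_mul_of_one_le_left hΦt h2)
  have h5 (i) : ENNReal.ofReal (cFactor (A i t) (q i) (γ i) * matNorm (1 - A i t) ^ β i) =
      ENNReal.ofReal (cFactor (A i t) (q i) (γ i)) *
        ENNReal.ofReal (matNorm (1 - A i t) ^ β i) :=
    ENNReal.ofReal_mul' (Real.rpow_nonneg (matNorm_nonneg _) _)
  refine h1.trans ((mul_le_mul' (mul_le_mul' le_rfl (mul_le_mul' h4 le_rfl))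
    (Finset.prod_le_prod' fun i _ => hD i)).trans (le_of_eq ?_))
  simp only [h5, hN, hH, Finset.prod_mul_distrib]
  ring

end Commutator
end HausdorffHerz

open HausdorffHerz
theorem mainTheorem2 (n m : ℕ) (hn : 0 < n) (hm : 0 < m)
    -- the kernel, the matrices and the symbols
    (Φ : EuclideanSpace ℝ (Fin n) → ℝ) (hΦ0 : ∀ t, 0 ≤ Φ t) (hΦ : AEMeasurable Φ volume)
    (A : Fin m → EuclideanSpace ℝ (Fin n) → Matrix (Fin n) (Fin n) ℝ)
    (hA : ∀ i j k, AEMeasurable (fun t => A i t j k) volume)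
    (hAinv : ∀ i, ∀ᵐ t, Φ t ≠ 0 → IsUnit (A i t))
    (β : Fin m → ℝ) (hβ0 : ∀ i, 0 < β i) (hβ1 : ∀ i, β i ≤ 1)
    (b : Fin m → EuclideanSpace ℝ (Fin n) → ℂ) (hb : ∀ i, MemHolder (β i).toNNReal (b i))
    -- the exponents
    (ζ : ℝ) (hζ : 0 < ζ)
    (q : Fin m → EuclideanSpace ℝ (Fin n) → ℝ≥0∞) (hq : ∀ i, IsBoundedExponent (q i))
    (r : Fin m → EuclideanSpace ℝ (Fin n) → ℝ≥0∞) (rInf : Fin m → ℝ≥0∞)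
    (hr : ∀ i, IsExponentWithLimit (r i) (rInf i))
    (hqT : IsBoundedExponent (qTarget q r))
    (γ : Fin m → ℝ)
    (α : Fin m → EuclideanSpace ℝ (Fin n) → ℝ) (αInf : Fin m → ℝ)
    (hα : ∀ i, MemLp (α i) ∞ volume) (hα0 : ∀ i, LogHolderAtZero (α i))
    (hαInf : ∀ i, LogHolderAtInfinity (α i) (αInf i))
    (hαS : MemLp (alphaStar α β γ r) ∞ volume) (hαS0 : LogHolderAtZero (alphaStar α β γ r))
    (hαSInf : ∃ a, LogHolderAtInfinity (alphaStar α β γ r) a)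
    (hα_eq : ∀ i, α i 0 = αInf i)
    (p : ℝ) (hp : 1 ≤ p) (P : Fin m → ℝ) (hP : ∀ i, 1 ≤ P i) (hpP : ∑ i, 1 / P i = 1 / p)
    -- the structural conditions
    (hqζ : ∀ i, ∀ᵐ t, Φ t ≠ 0 → ∀ᵐ x, q i (act (A i t)⁻¹ x) ≤ ENNReal.ofReal ζ * q i x)
    (hϑ : ∀ i, ∀ᵐ t, Φ t ≠ 0 → varNorm (theta ζ (q i) (A i t)) (fun _ => 1) < ∞)
    (hγr : (∀ i, -(n : ℝ) < γ i ∧ r i 0 = essSup (r i) volume ∧ rInf i = essInf (r i) volume) ∨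
      (∀ i, γ i < -(n : ℝ) ∧ r i 0 = essInf (r i) volume ∧ rInf i = essSup (r i) volume) ∨
      (∀ i, γ i = -(n : ℝ)))
    (hC2 : constC2 Φ A ζ p q β γ α αInf < ∞) :
    -- boundedness from the product of Herz spaces to the target Herz space
    ∃ C : ℝ≥0, ∀ f : Fin m → EuclideanSpace ℝ (Fin n) → ℂ,
      (∀ i, MemHerz (α i) (P i) (fun x => ENNReal.ofReal ζ * q i x) (fun x => ‖x‖ ^ γ i) (f i)) →
      (∀ᵐ x, Integrable (commIntegrand Φ A b f x) volume) ∧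
      MemHerz (alphaStar α β γ r) p (qTarget q r) (fun x => ‖x‖ ^ gammaTarget γ r x)
        (hausdorffCommutator Φ A b f) ∧
      herzNorm (alphaStar α β γ r) p (qTarget q r) (fun x => ‖x‖ ^ gammaTarget γ r x)
          (hausdorffCommutator Φ A b f) ≤
        C * ∏ i, herzNorm (α i) (P i) (fun x => ENNReal.ofReal ζ * q i x) (fun x => ‖x‖ ^ γ i)
          (f i) := by
  choose C _ hC using fun i => exists_abs_mul_sub_le (hα0 i) (hαInf i) (hα_eq i)
  choose B hB using hb
  have hrE (i) : IsExponent (r i) := (hr i).toIsExponent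
  choose c hc using fun i => exists_lux_rPiece_le (γ i) (hrE i)
  have hαm (i) : AEMeasurable (α i) volume := (hα i).aestronglyMeasurable.aemeasurable
  have hαSm : AEMeasurable (alphaStar α β γ r) volume := hαS.aestronglyMeasurable.aemeasurable
  have hγTm : AEMeasurable (gammaTarget γ r) volume := aemeasurable_gammaTarget hrE
  have hwm : AEMeasurable (fun x => ‖x‖ ^ gammaTarget γ r x) volume :=
    measurable_norm.aemeasurable.pow hγTm
  have hp0 : 0 < p := zero_lt_one.trans_le hp
  have hbm (i) : Measurable (b i) :=
    ((hB i).continuous (Real.toNNReal_pos.2 (hβ0 i))).measurable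
  set κ : ℝ≥0∞ := ((m + m : ℕ) : ℝ≥0∞) * (∏ i, (c i : ℝ≥0∞)) * m * (∏ i, (B i : ℝ≥0∞)) *
    (∏ i, ENNReal.ofReal (2 * 2 ^ (2 * C i + |α i 0|))) with hκ
  have hκt : κ ≠ ∞ := by
    refine ENNReal.mul_ne_top (ENNReal.mul_ne_top (ENNReal.mul_ne_top (ENNReal.mul_ne_top ?_ ?_) ?_)
      ?_) ?_
    · exact ENNReal.natCast_ne_top _
    · exact ENNReal.prod_ne_top fun _ _ => ENNReal.coe_ne_top
    · exact ENNReal.natCast_ne_top _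
    · exact ENNReal.prod_ne_top fun _ _ => ENNReal.coe_ne_top
    · exact ENNReal.prod_ne_top fun _ _ => ENNReal.ofReal_ne_top
  have hKt : κ * constC2 Φ A ζ p q β γ α αInf ≠ ∞ := ENNReal.mul_ne_top hκt hC2.ne
  refine ⟨(κ * constC2 Φ A ζ p q β γ α αInf).toNNReal, fun f hf => ?_⟩
  rw [ENNReal.coe_toNNReal hKt]
  set W := ∏ i, herzNorm (α i) (P i) (fun x => ENNReal.ofReal ζ * q i x) (fun x => ‖x‖ ^ γ i) (f i)
    with hW
  have hWt : W ≠ ∞ := ENNReal.prod_ne_top fun i _ => (hf i).norm_lt_top.ne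
  have hfm (i) : AEMeasurable (f i) volume := (hf i).aestronglyMeasurable.aemeasurable
  have hjoint := aemeasurable_commIntegrand hΦ hA hAinv hbm hfm
  set g : EuclideanSpace ℝ (Fin n) → EuclideanSpace ℝ (Fin n) → ℝ≥0∞ :=
    fun t x => ‖commIntegrand Φ A b f x t‖ₑ with hg
  have hgm : AEMeasurable (Function.uncurry g) (volume.prod volume) := hjoint.enorm
  set I : EuclideanSpace ℝ (Fin n) → ℝ≥0∞ := fun x => ∫⁻ t, g t x with hI
  have hIm : AEMeasurable I volume := hgm.prod_swap.lintegral_prod_right'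
  have hmain : lux Measure.count (fun _ => ENNReal.ofReal p) (fun k : ℤ =>
      lux volume (qTarget q r) (piece (alphaStar α β γ r) (fun x => ‖x‖ ^ gammaTarget γ r x) I k)) ≤
      κ * constC2 Φ A ζ p q β γ α αInf * W := by
    refine (lux_count_piece_lintegral_le hqT hαSm hwm hp hgm).trans ?_
    rw [mul_right_comm, constC2, ← lintegral_const_mul' _ _ (ENNReal.mul_ne_top hκt hWt)]
    -- a pointwise bound suffices: measurability of the integrand of `constC2` plays no role
    refine lintegral_mono_ae ?_
    filter_upwards [ae_all_iff.2 hAinv, ae_all_iff.2 hqζ, ae_all_iff.2 hϑ] with t h1 h2 h3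
    by_cases h0 : Φ t = 0
    · -- the integrand vanishes where `Φ` does
      have hz (k : ℤ) : piece (alphaStar α β γ r) (fun x => ‖x‖ ^ gammaTarget γ r x) (g t) k =
          fun _ => 0 := by
        ext x
        simp [piece, hg, commIntegrand, h0]
      simp only [hz, lux_zero hqT.ne_zero hqT.ne_top]
      rw [lux_zero (fun _ => by simpa using hp0) (fun _ => ENNReal.ofReal_ne_top)]
      exact zero_le
    · simp only [← hα_eq]
      exact lux_count_commIntegrand_le_constC2 hn hm hΦ0 hβ0 hB hq hrE hqT hαm hC hc hp hP hpP hfm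
        (fun i => (hf i).norm_lt_top.ne) (fun i => h1 i h0) (fun i => h2 i h0) (fun i => h3 i h0)
  have hmain_t : lux Measure.count (fun _ => ENNReal.ofReal p) (fun k : ℤ =>
      lux volume (qTarget q r)
        (piece (alphaStar α β γ r) (fun x => ‖x‖ ^ gammaTarget γ r x) I k)) ≠ ∞ :=
    ne_top_of_le_ne_top (ENNReal.mul_ne_top hKt hWt) hmain
  have hIfin : ∀ᵐ x, I x < ∞ :=
    ae_lt_top_of_lux_piece_ne_top hn hqT hαSm hwm
      (fun x hx => Real.rpow_pos_of_pos (norm_pos_iff.2 hx) _) hIm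
      fun k => ne_top_of_le_ne_top hmain_t (le_lux_count hp0 _ k)
  have hHI (x) : ‖hausdorffCommutator Φ A b f x‖ₑ ≤ I x := enorm_integral_le_lintegral_enorm _
  have hHm : AEStronglyMeasurable (hausdorffCommutator Φ A b f) volume :=
    hjoint.prod_swap.aestronglyMeasurable.integral_prod_right'
  have hpiece (k : ℤ) : lux volume (qTarget q r) (piece (alphaStar α β γ r)
        (fun x => ‖x‖ ^ gammaTarget γ r x) (fun x => ‖hausdorffCommutator Φ A b f x‖ₑ) k) ≤
      lux volume (qTarget q r)
        (piece (alphaStar α β γ r) (fun x => ‖x‖ ^ gammaTarget γ r x) I k) := by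
    refine lux_mono (ae_of_all _ fun x => Set.indicator_le_indicator ?_)
    exact mul_le_mul' le_rfl (hHI x)
  have hbound : herzNorm (alphaStar α β γ r) p (qTarget q r) (fun x => ‖x‖ ^ gammaTarget γ r x)
      (hausdorffCommutator Φ A b f) ≤ κ * constC2 Φ A ζ p q β γ α αInf * W := by
    rw [herzNorm_eq_lux (fun x => by positivity) hp0]
    exact (lux_mono (ae_of_all _ hpiece)).trans hmain
  obtain ⟨M, hM⟩ := hαS0.exists_abs_le
  -- absolute convergence, local finiteness and finiteness of the Herz norm
  refine ⟨?_, ⟨hHm, fun K hK hK0 => ?_, ?_⟩, hbound⟩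
  · filter_upwards [hIfin, hjoint.prod_swap.aestronglyMeasurable.prodMk_left] with x hx hxm
    exact ⟨hxm, hx⟩
  · exact varNorm_indicator_lt_top hαSm hγTm hM (abs_gammaTarget_le hrE) hqT hHm.aemeasurable
      (fun k => ne_top_of_le_ne_top (ne_top_of_le_ne_top hmain_t (le_lux_count hp0 _ k)) (hpiece k))
      hK hK0
  · exact hbound.trans_lt (ENNReal.mul_lt_top hKt.lt_top hWt.lt_top)
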